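/- Let $F=\mathbb F_q$ be a finite field of odd characteristic with $q$ elements and let $\chi$ be its quadratic character ($\chi(0)=0$). For $p\in F[t]\setminus\{0\}$ put $\chi(p(\infty))=0$ if $\deg p$ is odd, and, if $\deg p$ is even, $\chi(p(\infty))=1$ or $-1$ according to whether the leading coefficient of $p$ is a square in $F$ or not. For $f,f_1,f_2\in F[t]$ put $$\widehat S(f,f_1,f_2)=\sum_{x\in\mathbb P^1(F)}\bigl(\chi(ff_1(x))+\chi(ff_2(x))+\chi(f_1f_2(x))\bigr).$$ Let $\widehat{\mathcal F}_{(n,n_1,n_2)}$ be the set of triples $(f,f_1,f_2)$ of pairwise coprime square-free polynomials over $F$ of degrees $n,n_1,n_2$ with $f$ monic (empty if a degree is negative), and let $$\widehat{\mathcal F}_{[n,n_1,n_2]}=\widehat{\mathcal F}_{(n,n_1,n_2)}\cup\widehat{\mathcal F}_{(n-1,n_1,n_2)}\cup\widehat{\mathcal F}_{(n,n_1-1,n_2)}\cup\widehat{\mathcal F}_{(n,n_1,n_2-1)}.$$ For $M\in\mathbb Z$ let $$R_q(M;n,n_1,n_2)=\frac{|\{(f,f_1,f_2)\in\widehat{\mathcal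 F}_{[n,n_1,n_2]}:\widehat S(f,f_1,f_2)=M\}|}{|\widehat{\mathcal F}_{[n,n_1,n_2]}|},\qquad P_q(M)=\mathrm{Prob}(X_1+\dots+X_{q+1}=M),$$ where $X_1,\dots,X_{q+1}$ are i.i.d. and take the values $-1,1,3$ with probabilities $\frac{3(q+2)}{4(q+3)}$, $\frac{6}{4(q+3)}$, $\frac{q}{4(q+3)}$. (1) For every such $F$ and every $M\in\mathbb Z$, $R_q(M;n,n_1,n_2)\to P_q(M)$ as $n,n_1,n_2\to\infty$ through triples with $n\equiv n_1\equiv n_2\pmod 2$. (2) For every $0<\epsilon<1$ there is a constant $C$, depending only on $\epsilon$, such that for every such $F$, every $M\in\mathbb Z$ and all integers $n,n_1,n_2\ge 0$ with $n\equiv n_1\equiv n_2\pmod 2$, $$\bigl|R_q(M;n,n_1,n_2)-P_q(M)\bigr|\le P_q(M)\cdot C\,q^{-\frac{1-\epsilon}{2}\min(n,n_1,n_2)+q}.$$ -/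

import Mathlib

open Polynomial MeasureTheory Filter

universe u

/-- `ℱ̂_(d,d₁,d₂)`: triples of pairwise coprime square-free polynomials over `F` of degrees
`d, d₁, d₂`, the first of which is monic. -/
def coprimeTriples (F : Type*) [Field F] (d d₁ d₂ : ℕ) : Set (F[X] × F[X] × F[X]) :=
  {t | t.1.Monic ∧ Squarefree t.1 ∧ Squarefree t.2.1 ∧ Squarefree t.2.2 ∧
    t.1.natDegree = d ∧ t.2.1.natDegree = d₁ ∧ t.2.2.natDegree = d₂ ∧
    IsCoprime t.1 t.2.1 ∧ IsCoprime t.1 t.2.2 ∧ IsCoprime t.2.1 t.2.2}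

/-- `ℱ̂_[n,n₁,n₂]`: the union of `ℱ̂_(n,n₁,n₂)`, `ℱ̂_(n-1,n₁,n₂)`, `ℱ̂_(n,n₁-1,n₂)` and
`ℱ̂_(n,n₁,n₂-1)`; a component with a negative degree is empty. -/
def biquadraticTriples (F : Type*) [Field F] (n n₁ n₂ : ℕ) : Set (F[X] × F[X] × F[X]) :=
  {t | t ∈ coprimeTriples F n n₁ n₂ ∨
    (∃ d, d + 1 = n ∧ t ∈ coprimeTriples F d n₁ n₂) ∨
    (∃ d, d + 1 = n₁ ∧ t ∈ coprimeTriples F n d n₂) ∨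
    (∃ d, d + 1 = n₂ ∧ t ∈ coprimeTriples F n n₁ d)}

/-- `χ(p(x))` for a point `x` of `ℙ¹(F)`, where `χ` is the quadratic character of `F` and `none`
is the point at infinity. At infinity the value is `0` if the degree of `p` is odd, and otherwise
`1` or `-1` according to whether the leading coefficient of `p` is a square or not. -/
noncomputable def chiAt {F : Type*} [Field F] [Fintype F] [DecidableEq F] (p : F[X]) : Option F → ℤ
  | some x => quadraticChar F (p.eval x)
  | none => if Odd p.natDegree then 0 else quadraticChar F p.leadingCoeff

/-- `Ŝ(f,f₁,f₂)`, the sum of `χ(f f₁(x)) + χ(f f₂(x)) + χ(f₁ f₂(x))` over `x ∈ ℙ¹(F)`. -/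
noncomputable def traceSum {F : Type*} [Field F] [Fintype F] [DecidableEq F] (t : F[X] × F[X] × F[X]) : ℤ :=
  ∑ x : Option F,
    (chiAt (t.1 * t.2.1) x + chiAt (t.1 * t.2.2) x + chiAt (t.2.1 * t.2.2) x)

/-- The proportion of the triples `(f,f₁,f₂)` in `ℱ̂_[n,n₁,n₂]` with `Ŝ(f,f₁,f₂) = M`. -/
noncomputable def traceProportion (F : Type*) [Field F] [Fintype F] [DecidableEq F]
    (M : ℤ) (n n₁ n₂ : ℕ) : ℝ :=
  ({t ∈ biquadraticTriples F n n₁ n₂ | traceSum t = M}.ncard : ℝ) /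
    ((biquadraticTriples F n n₁ n₂).ncard : ℝ)

/-- The common law of the variables `X_j`: the probability measure on `ℤ` with masses
`3(q+2)/(4(q+3))`, `6/(4(q+3))`, `q/(4(q+3))` at `-1`, `1`, `3`. -/
noncomputable def traceLaw (q : ℕ) : Measure ℤ :=
  ENNReal.ofReal (3 * ((q : ℝ) + 2) / (4 * ((q : ℝ) + 3))) • Measure.dirac (-1) +
  ENNReal.ofReal (6 / (4 * ((q : ℝ) + 3))) • Measure.dirac 1 +
  ENNReal.ofReal ((q : ℝ) / (4 * ((q : ℝ) + 3))) • Measure.dirac 3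

instance traceLaw_isProbabilityMeasure (q : ℕ) : IsProbabilityMeasure (traceLaw q) := by
  constructor
  simp only [traceLaw, Measure.coe_add, Measure.coe_smul, Pi.add_apply, Pi.smul_apply,
    measure_univ, smul_eq_mul, mul_one]
  rw [← ENNReal.ofReal_add (by positivity) (by positivity),
    ← ENNReal.ofReal_add (by positivity) (by positivity), ← ENNReal.ofReal_one]
  congr 1
  field_simp
  ring

/-- `Prob(X_1 + ⋯ + X_{q+1} = M)` for independent `X_j` with law `traceLaw q`: the `X_j` are the
coordinates of the product probability space. -/
noncomputable def traceProb (q : ℕ) (M : ℤ) : ℝ :=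
  (Measure.pi fun _ : Fin (q + 1) => traceLaw q).real {x | ∑ j, x j = M}

/-- `n ≡ n₁ ≡ n₂ (mod 2)`. Exactly then all the hyperelliptic curves `y² = f f₁`, `y² = f f₂`,
`y² = f₁ f₂` attached to the four components of `ℱ̂_[n,n₁,n₂]` have the same three genera. -/
def SameParity (n n₁ n₂ : ℕ) : Prop :=
  n % 2 = n₁ % 2 ∧ n₁ % 2 = n₂ % 2

/-! Make the three polynomials monic and fix their values `r x i` at all affine points. Without
square-freeness, interpolation counts such triples exactly: the values at the q points are
equidistributed once the degrees are at least q. Square-freeness of the product (equivalently,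
square-free and pairwise coprime factors) is imposed by a sieve over monic irreducible P, each
giving a local factor. A P without roots is blind to the values and contributes a constant, while P
= X - x contributes `localWeight (r x)`: 1 if no value vanishes at x, 1 - 1/q if exactly one does, 0
otherwise. In the main term the values at distinct points are therefore independent.

Under this weight the contribution of a point has the law of X_j. With no zero it is 3 or -1, with
probabilities 1/4 and 3/4; with one zero it is a fair sign; the two cases have total weights in the
ratio 1 : 3/q. The point at infinity behaves in the same way because four components are united. The
first plays the role of "no zero"; each of the other three, smaller by a factor q, has one degree of
the other parity and so kills two of the three characters. Hence there are q+1 independent copies.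

For the error term, each sieve summand is either exact or has a modulus so large that count and
density are both tiny. Interpolating with an exponent θ < 1/2 keeps the sieve sum absolutely
convergent and saves q^(-θm), where m bounds the degrees from below (`abs_countDvd_sub_le`,
`abs_countValues_sub_le`). The main term is bounded below, so the error is relative
(`abs_countValues_sub_le_mul`) and passes unchanged through sums with nonnegative weights
(`abs_sum_biquadraticFinset_sub_le`). When the relative error is not small, the bound is trivial,
because attained values of M have P_q(M) ≥ 1000^(-q) (`pow_le_traceProb`). Factors exponential in q
are absorbed by the slack between ε and ε/2 in the exponent. -/

/-! ### Monic polynomials with prescribed values. -/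

theorem finite_monic_natDegree (F : Type*) [Field F] [Fintype F] (n : ℕ) :
    {f : F[X] | f.Monic ∧ f.natDegree = n}.Finite :=
  Set.finite_coe_iff.1
    (Finite.of_equiv _ ((monicEquivDegreeLT n).trans (degreeLTEquiv F n).toEquiv).symm)

/-- The monic polynomials of degree `n` over a finite field. -/
noncomputable def monicPolys (F : Type*) [Field F] [Fintype F] (n : ℕ) : Finset F[X] :=
  (finite_monic_natDegree F n).toFinset

section
variable {F : Type*} [Field F] [Fintype F]

theorem mem_monicPolys {n : ℕ} {f : F[X]} :
    f ∈ monicPolys F n ↔ f.Monic ∧ f.natDegree = n := by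
  simp [monicPolys]

theorem card_monicPolys (n : ℕ) : (monicPolys F n).card = Fintype.card F ^ n := by
  rw [monicPolys, ← Set.ncard_eq_toFinset_card _ (finite_monic_natDegree F n)]
  have := Nat.card_congr ((monicEquivDegreeLT n).trans (degreeLTEquiv F n).toEquiv)
  rw [Nat.card_fun, Nat.card_eq_fintype_card (α := F), Nat.card_fin] at this
  exact this

open Classical in
-- The difference of two such polynomials has degree below k and at least k roots.
theorem card_monicPolys_eval_le_one (S : Finset F) (v : F → F) {k : ℕ} (hk : k ≤ S.card) :
    ((monicPolys F k).filter fun f => ∀ x ∈ S, f.eval x = v x).card ≤ 1 := by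
  rw [Finset.card_le_one]
  intro f hf g hg
  simp only [Finset.mem_filter, mem_monicPolys] at hf hg
  refine eq_of_degree_sub_lt_of_eval_finset_eq S ?_ fun x hx => by rw [hf.2 x hx, hg.2 x hx]
  refine lt_of_lt_of_le ?_ (Nat.cast_le.2 hk)
  have := degree_sub_lt_left (p := f) (q := g) ?_ hf.1.1.ne_zero (by rw [hf.1.1, hg.1.1])
  · rwa [degree_eq_natDegree hf.1.1.ne_zero, hf.1.2] at this
  · rw [degree_eq_natDegree hf.1.1.ne_zero, degree_eq_natDegree hg.1.1.ne_zero, hf.1.2, hg.1.2]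

open Classical in
-- Dividing by the nodal polynomial of S, with the Lagrange interpolant as remainder, leaves a free
-- monic quotient of degree k - |S|.
theorem card_monicPolys_eval (S : Finset F) (v : F → F) {k : ℕ} (hk : S.card ≤ k) :
    ((monicPolys F k).filter fun f => ∀ x ∈ S, f.eval x = v x).card =
      Fintype.card F ^ (k - S.card) := by
  rw [← card_monicPolys]
  symm
  have hinj : Set.InjOn (id : F → F) S := Function.injective_id.injOn
  have hdeg := Lagrange.degree_interpolate_lt (r := v) hinj
  have hN : (Lagrange.nodal S (id : F → F)).Monic := Lagrange.nodal_monic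
  have hNd : (Lagrange.nodal S (id : F → F)).natDegree = S.card := Lagrange.natDegree_nodal
  refine Finset.card_bij
    (fun g _ => Lagrange.nodal S id * g + Lagrange.interpolate S id v) ?_ ?_ ?_
  · intro g hg
    rw [mem_monicPolys] at hg
    have hm : (Lagrange.nodal S (id : F → F) * g).Monic := hN.mul hg.1
    have hd : (Lagrange.nodal S (id : F → F) * g).natDegree = k := by
      rw [hN.natDegree_mul hg.1, hNd, hg.2]; omega
    have hlt : (Lagrange.interpolate S id v).degree < (Lagrange.nodal S (id : F → F) * g).degree := by
      rw [degree_eq_natDegree hm.ne_zero, hd]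
      exact hdeg.trans_le (Nat.cast_le.2 hk)
    simp only [Finset.mem_filter, mem_monicPolys]
    refine ⟨⟨hm.add_of_left hlt, by rw [natDegree_add_eq_left_of_degree_lt hlt, hd]⟩, fun x hx => ?_⟩
    have h1 := Lagrange.eval_nodal_at_node (v := (id : F → F)) hx
    have h2 := Lagrange.eval_interpolate_at_node (r := v) hinj hx
    simp only [id] at h1 h2
    rw [eval_add, eval_mul]
    rw [h1, h2]
    simp
  · intro g _ g' _ h
    exact mul_left_cancel₀ hN.ne_zero (add_right_cancel h)
  · intro f hf
    simp only [Finset.mem_filter, mem_monicPolys] at hf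
    have hdvd : Lagrange.nodal S (id : F → F) ∣ f - Lagrange.interpolate S id v := by
      rw [Lagrange.nodal_eq]
      refine Finset.prod_dvd_of_coprime ?_ ?_
      · intro x _ y _ hxy
        exact pairwise_coprime_X_sub_C Function.injective_id hxy
      · intro x hx
        rw [dvd_iff_isRoot]
        have h2 := Lagrange.eval_interpolate_at_node (r := v) hinj hx
        simp only [id] at h2
        rw [id, IsRoot, eval_sub]
        rw [hf.2 x hx, h2, sub_self]
    obtain ⟨g, hg⟩ := hdvd
    have hlt : (Lagrange.interpolate S id v).degree < f.degree := by
      rw [degree_eq_natDegree hf.1.1.ne_zero, hf.1.2]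
      exact hdeg.trans_le (Nat.cast_le.2 hk)
    have hm : (Lagrange.nodal S (id : F → F) * g).Monic := by
      rw [← hg]; exact hf.1.1.sub_of_left hlt
    have hgm : g.Monic := hN.of_mul_monic_left hm
    have hd : (Lagrange.nodal S (id : F → F) * g).natDegree = k := by
      rw [← hg, sub_eq_add_neg, natDegree_add_eq_left_of_degree_lt (by rwa [degree_neg]), hf.1.2]
    refine ⟨g, ?_, by rw [← hg]; ring⟩
    rw [mem_monicPolys]
    refine ⟨hgm, ?_⟩
    rw [hN.natDegree_mul hgm, hNd] at hd
    omega
end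

/-! ### Multiples of a modulus among polynomials with prescribed values. -/

section
variable {F : Type*} [Field F] [Fintype F]

open Classical in
/-- The number of monic multiples of `A` of degree `n` taking the values `r`. -/
noncomputable def countDvd (r : F → F) (n : ℕ) (A : F[X]) : ℕ :=
  ((monicPolys F n).filter fun f => (∀ x, f.eval x = r x) ∧ A ∣ f).card

open Classical in
/-- The roots in `F` of a polynomial. -/
noncomputable def zeroSet (A : F[X]) : Finset F := Finset.univ.filter fun x => A.eval x = 0

open Classical in
/-- The density of the multiples of `A` among the polynomials taking the values `r`. -/
noncomputable def dvdDensity (r : F → F) (A : F[X]) : ℝ :=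
  if ∀ x, A.eval x = 0 → r x = 0 then
    (Fintype.card F : ℝ) ^ (zeroSet A).card / (Fintype.card F : ℝ) ^ A.natDegree else 0

theorem mem_zeroSet {A : F[X]} {x : F} : x ∈ zeroSet A ↔ A.eval x = 0 := by simp [zeroSet]

theorem card_zeroSet_le {A : F[X]} (hA : A ≠ 0) : (zeroSet A).card ≤ A.natDegree := by
  classical
  refine (Finset.card_le_card (t := A.roots.toFinset) fun x hx => ?_).trans
    ((Multiset.toFinset_card_le _).trans (card_roots' A))
  simpa [hA] using mem_zeroSet.1 hx

open Classical in
theorem countDvd_eq {r : F → F} {n : ℕ} {A : F[X]} (hA : A.Monic) (hn : A.natDegree ≤ n)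
    (hr : ∀ x, A.eval x = 0 → r x = 0) :
    countDvd r n A = ((monicPolys F (n - A.natDegree)).filter fun g =>
      ∀ x ∈ (zeroSet A)ᶜ, g.eval x = r x / A.eval x).card := by
  symm
  refine Finset.card_bij (fun g _ => A * g) ?_ ?_ ?_
  · intro g hg
    simp only [Finset.mem_filter, mem_monicPolys, Finset.mem_compl, mem_zeroSet] at hg ⊢
    refine ⟨⟨hA.mul hg.1.1, by rw [hA.natDegree_mul hg.1.1]; omega⟩, fun x => ?_, dvd_mul_right _ _⟩
    rw [eval_mul]
    by_cases hx : A.eval x = 0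
    · rw [hx, hr x hx, zero_mul]
    · rw [hg.2 x hx]; field_simp
  · intro g _ g' _ h
    exact mul_left_cancel₀ hA.ne_zero h
  · intro f hf
    simp only [Finset.mem_filter, mem_monicPolys] at hf
    obtain ⟨⟨hf1, hf2⟩, hf3, g, rfl⟩ := hf
    have hg : g.Monic := hA.of_mul_monic_left hf1
    refine ⟨g, ?_, rfl⟩
    simp only [Finset.mem_filter, mem_monicPolys, Finset.mem_compl, mem_zeroSet]
    refine ⟨⟨hg, ?_⟩, fun x hx => ?_⟩
    · rw [hA.natDegree_mul hg] at hf2; omega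
    · have := hf3 x
      rw [eval_mul] at this
      rw [← this]; field_simp

theorem countDvd_eq_zero_of_lt {r : F → F} {n : ℕ} {A : F[X]} (hn : n < A.natDegree) :
    countDvd r n A = 0 := by
  classical
  rw [countDvd, Finset.card_eq_zero, Finset.filter_eq_empty_iff]
  rintro f hf ⟨-, h⟩
  rw [mem_monicPolys] at hf
  have := natDegree_le_of_dvd h hf.1.ne_zero
  omega

theorem countDvd_eq_zero_of_eval {r : F → F} {n : ℕ} {A : F[X]}
    (hr : ¬ ∀ x, A.eval x = 0 → r x = 0) : countDvd r n A = 0 := by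
  classical
  rw [countDvd, Finset.card_eq_zero, Finset.filter_eq_empty_iff]
  rintro f hf ⟨h, g, rfl⟩
  refine hr fun x hx => ?_
  rw [← h, eval_mul, hx, zero_mul]

theorem one_lt_card_real : (1 : ℝ) < Fintype.card F := by
  exact_mod_cast Fintype.one_lt_card

theorem dvdDensity_nonneg (r : F → F) (A : F[X]) : 0 ≤ dvdDensity r A := by
  unfold dvdDensity
  split_ifs <;> positivity

/-- The factor `dvdDensity r A ^ (1 - θ)` can still be summed over sieve moduli, while the power θ
given up pays for the saving q^(-θm). The hypothesis q ≤ θm makes the saving at most 1, so that the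
same power also dominates the normalised count. -/
theorem abs_countDvd_sub_le {r : F → F} {n : ℕ} {A : F[X]} (hA : A.Monic) {θ m : ℝ}
    (hθ0 : 0 < θ) (hθ1 : θ ≤ 1) (hm : m ≤ n) (hq : (Fintype.card F : ℝ) ≤ θ * m) :
    dvdDensity r A ≤ dvdDensity r A ^ (1 - θ) ∧
    (countDvd r n A : ℝ) / (Fintype.card F : ℝ) ^ ((n : ℝ) - Fintype.card F) ≤
      dvdDensity r A ^ (1 - θ) ∧
    |(countDvd r n A : ℝ) / (Fintype.card F : ℝ) ^ ((n : ℝ) - Fintype.card F) - dvdDensity r A| ≤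
      (Fintype.card F : ℝ) ^ ((Fintype.card F : ℝ) - θ * m) * dvdDensity r A ^ (1 - θ) := by
  classical
  set q : ℝ := (Fintype.card F : ℝ) with hqdef
  have hq1 : 1 < q := one_lt_card_real
  have hq0 : 0 < q := by linarith
  by_cases hr : ∀ x, A.eval x = 0 → r x = 0
  swap
  · have h0 : dvdDensity r A = 0 := by rw [dvdDensity, if_neg hr]
    rw [countDvd_eq_zero_of_eval hr, h0]
    have := Real.rpow_nonneg (le_refl (0 : ℝ)) (1 - θ)
    refine ⟨this, by simpa using this, ?_⟩
    simp only [Nat.cast_zero, zero_div, sub_zero, abs_zero]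
    positivity
  set w := (zeroSet A).card with hw
  set a := A.natDegree with ha
  have hwa : w ≤ a := card_zeroSet_le hA.ne_zero
  have hwq : w ≤ Fintype.card F := Finset.card_le_univ _
  have hδ : dvdDensity r A = q ^ ((w : ℝ) - a) := by
    rw [dvdDensity, if_pos hr, Real.rpow_sub hq0, Real.rpow_natCast, Real.rpow_natCast]
  have hδη : dvdDensity r A ^ (1 - θ) = q ^ ((1 - θ) * ((w : ℝ) - a)) := by
    rw [hδ, ← Real.rpow_mul hq0.le, mul_comm]
  have hwa' : (w : ℝ) ≤ a := by exact_mod_cast hwa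
  have hwq' : (w : ℝ) ≤ q := by rw [hqdef]; exact_mod_cast hwq
  have hw0 : (0 : ℝ) ≤ w := Nat.cast_nonneg _
  have hScard : ((zeroSet A)ᶜ).card = Fintype.card F - w := by rw [Finset.card_compl]
  have hle : dvdDensity r A ≤ dvdDensity r A ^ (1 - θ) := by
    rw [hδη, hδ]
    apply Real.rpow_le_rpow_of_exponent_le hq1.le
    nlinarith
  -- The cofactor has degree n - a and q - w prescribed values. If n - a ≥ q - w the count is exact;
  -- otherwise at most one cofactor exists, and count and density are bounded separately.
  by_cases hex : a + Fintype.card F ≤ n + w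
  · have hcount : (countDvd r n A : ℝ) / q ^ ((n : ℝ) - q) = dvdDensity r A := by
      rw [countDvd_eq hA (by omega) hr, card_monicPolys_eval _ _ (by rw [hScard]; omega), hScard, hδ]
      push_cast
      rw [← hqdef, ← Real.rpow_natCast q, ← Real.rpow_sub hq0]
      congr 1
      have h1 : Fintype.card F - w ≤ n - a := by omega
      have h2 : a ≤ n := by omega
      rw [Nat.cast_sub h1, Nat.cast_sub h2, Nat.cast_sub hwq]
      rw [← hqdef]; ring
    rw [hcount, sub_self, abs_zero]
    exact ⟨hle, hle, by rw [hδη]; positivity⟩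
  · have hex' : (n : ℝ) + w < a + q := by
      rw [hqdef]; exact_mod_cast Nat.lt_of_not_le hex
    have hδx : dvdDensity r A ≤ q ^ (q - θ * m) * dvdDensity r A ^ (1 - θ) := by
      rw [hδη, hδ, ← Real.rpow_add hq0]
      apply Real.rpow_le_rpow_of_exponent_le hq1.le
      nlinarith
    have hcx : (countDvd r n A : ℝ) / q ^ ((n : ℝ) - q) ≤
        q ^ (q - θ * m) * dvdDensity r A ^ (1 - θ) := by
      by_cases han : n < a
      · rw [countDvd_eq_zero_of_lt han, hδη]
        simp only [Nat.cast_zero, zero_div]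
        positivity
      · have hc1 : (countDvd r n A : ℝ) ≤ 1 := by
          rw [countDvd_eq hA (by omega) hr]
          exact_mod_cast card_monicPolys_eval_le_one _ _ (by rw [hScard]; omega)
        have han' : (a : ℝ) ≤ n := by exact_mod_cast Nat.le_of_not_lt han
        rw [div_le_iff₀ (by positivity), hδη, ← Real.rpow_add hq0, ← Real.rpow_add hq0]
        refine hc1.trans (Real.one_le_rpow hq1.le ?_)
        nlinarith
    have hx1 : q ^ (q - θ * m) ≤ 1 := Real.rpow_le_one_of_one_le_of_nonpos hq1.le (by linarith)
    have hωnn : 0 ≤ dvdDensity r A ^ (1 - θ) := Real.rpow_nonneg (dvdDensity_nonneg _ _) _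
    refine ⟨hle, hcx.trans (mul_le_of_le_one_left hωnn hx1), ?_⟩
    have h1 : 0 ≤ (countDvd r n A : ℝ) / q ^ ((n : ℝ) - q) := by positivity
    have h2 := dvdDensity_nonneg r A
    rw [abs_le]
    constructor <;> linarith

theorem dvdDensity_one (r : F → F) : dvdDensity r 1 = 1 := by
  simp [dvdDensity, zeroSet]

theorem dvdDensity_mul (r : F → F) {A B : F[X]} (hA : A ≠ 0) (hB : B ≠ 0) (hAB : IsCoprime A B) :
    dvdDensity r (A * B) = dvdDensity r A * dvdDensity r B := by
  classical
  by_cases h1 : ∀ x, A.eval x = 0 → r x = 0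
  · by_cases h2 : ∀ x, B.eval x = 0 → r x = 0
    · have h3 : ∀ x, (A * B).eval x = 0 → r x = 0 := by
        intro x hx
        rw [eval_mul, mul_eq_zero] at hx
        exact hx.elim (h1 x) (h2 x)
      have hU : zeroSet (A * B) = zeroSet A ∪ zeroSet B := by
        ext x
        simp [mem_zeroSet]
      have hD : Disjoint (zeroSet A) (zeroSet B) := by
        rw [Finset.disjoint_left]
        intro x hx hx'
        rw [mem_zeroSet] at hx hx'
        obtain ⟨u, v, huv⟩ := hAB
        have := congrArg (eval x) huv
        simp [hx, hx'] at this
      rw [dvdDensity, dvdDensity, dvdDensity, if_pos h1, if_pos h2, if_pos h3, hU,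
        Finset.card_union_of_disjoint hD, natDegree_mul hA hB, pow_add, pow_add]
      field_simp
    · have h3 : ¬ ∀ x, (A * B).eval x = 0 → r x = 0 := fun h => h2 fun x hx =>
        h x (by rw [eval_mul, hx, mul_zero])
      rw [dvdDensity, dvdDensity, dvdDensity, if_neg h2, if_neg h3, mul_zero]
  · have h3 : ¬ ∀ x, (A * B).eval x = 0 → r x = 0 := fun h => h1 fun x hx =>
      h x (by rw [eval_mul, hx, zero_mul])
    rw [dvdDensity, dvdDensity, if_neg h1, if_neg h3, zero_mul]

theorem dvdDensity_prod (r : F → F) {ι : Type*} (s : Finset ι) (A : ι → F[X])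
    (hA : ∀ i ∈ s, A i ≠ 0) (hc : (s : Set ι).Pairwise (Function.onFun IsCoprime A)) :
    dvdDensity r (∏ i ∈ s, A i) = ∏ i ∈ s, dvdDensity r (A i) := by
  classical
  induction s using Finset.induction_on with
  | empty => simp [dvdDensity_one]
  | insert i s hi ih =>
    rw [Finset.prod_insert hi, Finset.prod_insert hi, dvdDensity_mul, ih]
    · exact fun j hj => hA j (Finset.mem_insert_of_mem hj)
    · exact hc.mono (by simp)
    · exact hA i (Finset.mem_insert_self _ _)
    · exact Finset.prod_ne_zero_iff.2 fun j hj => hA j (Finset.mem_insert_of_mem hj)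
    · refine IsCoprime.prod_right fun j hj => hc (by simp) (by simp [hj]) ?_
      rintro rfl
      exact hi hj

/-- Once the value 0 at x is prescribed, divisibility by the first factor X - x is automatic, so
only the remaining a factors cost anything. -/
theorem dvdDensity_X_sub_C_pow [DecidableEq F] (r : F → F) (x : F) (a : ℕ) :
    dvdDensity r ((X - C x) ^ (a + 1)) = if r x = 0 then 1 / (Fintype.card F : ℝ) ^ a else 0 := by
  classical
  have hz : zeroSet ((X - C x) ^ (a + 1)) = {x} := by
    ext y
    simp [mem_zeroSet, sub_eq_zero]
  have hiff : (∀ y, ((X - C x) ^ (a + 1)).eval y = 0 → r y = 0) ↔ r x = 0 := by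
    simp [sub_eq_zero]
  have hq : (Fintype.card F : ℝ) ≠ 0 := by exact_mod_cast Fintype.card_ne_zero
  by_cases h : r x = 0
  · rw [dvdDensity, if_pos (hiff.2 h), if_pos h, hz, natDegree_pow, natDegree_X_sub_C,
      Finset.card_singleton, mul_one, pow_succ]
    field_simp
    ring
  · rw [dvdDensity, if_neg (fun h' => h (hiff.1 h')), if_neg h]

theorem dvdDensity_pow_of_forall_eval_ne_zero (r : F → F) {P : F[X]} (hP : ∀ x, P.eval x ≠ 0)
    (a : ℕ) : dvdDensity r (P ^ a) = 1 / ((Fintype.card F : ℝ) ^ P.natDegree) ^ a := by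
  classical
  have hz : zeroSet (P ^ a) = ∅ := by
    ext y
    simp [mem_zeroSet, hP y]
  rw [dvdDensity, if_pos, hz, natDegree_pow, ← pow_mul, mul_comm a]
  · simp
  · intro x hx
    simp [hP x] at hx
end

/-! ### Coefficients of the local sieve identity. -/

/-- The coefficient of `u₀^e₀ u₁^e₁ u₂^e₂` in `(1 + u₀ + u₁ + u₂)(1 - u₀)(1 - u₁)(1 - u₂)`. -/
def sieveCoeff (e : Fin 3 → Fin 3) : ℤ :=
  ∑ j : Option (Fin 3), ∏ i, if j = some i then ![0, 1, -1] (e i) else ![1, -1, 0] (e i)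

/-- Here `k i a` stands for u_i^a, so 1 - u_i becomes `k i 0 - k i 1` and u_i(1 - u_i) becomes `k i
1 - k i 2`. Both divisibility indicators and densities are substituted for `k` later. -/
theorem sum_sieveCoeff_mul_prod {R : Type*} [CommRing R] (k : Fin 3 → Fin 3 → R) :
    ∑ e, (sieveCoeff e : R) * ∏ i, k i (e i) =
      ∑ j : Option (Fin 3), ∏ i, if j = some i then k i 1 - k i 2 else k i 0 - k i 1 := by
  have h : ∀ (j : Option (Fin 3)) (i : Fin 3),
      (if j = some i then k i 1 - k i 2 else k i 0 - k i 1) =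
      ∑ a : Fin 3, ((if j = some i then ![0, 1, -1] a else ![1, -1, 0] a : ℤ) : R) * k i a := by
    intro j i
    split_ifs <;> simp [Fin.sum_univ_three] <;> ring
  simp only [h, Fintype.prod_sum]
  rw [Finset.sum_comm]
  refine Finset.sum_congr rfl fun e _ => ?_
  rw [sieveCoeff, Int.cast_sum, Finset.sum_mul]
  refine Finset.sum_congr rfl fun j _ => ?_
  rw [Int.cast_prod, ← Finset.prod_mul_distrib]

theorem abs_sieveCoeff_le (e : Fin 3 → Fin 3) : |sieveCoeff e| ≤ 2 := by
  revert e; decide +kernel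

/-- The linear terms cancel between 1 + u₀ + u₁ + u₂ and the product of the 1 - u_i. This makes the
local factors 1 + O(z²), and hence the Euler product convergent. -/
theorem sieveCoeff_eq_zero_or (e : Fin 3 → Fin 3) :
    sieveCoeff e = 0 ∨ e = 0 ∨ 2 ≤ ∑ i, (e i : ℕ) := by
  revert e; decide +kernel

theorem sieveCoeff_zero : sieveCoeff 0 = 1 := by decide +kernel

theorem sum_abs_sieveCoeff_le_of_le_one (k : Fin 3 → Fin 3 → ℝ) (hk0 : ∀ i a, 0 ≤ k i a)
    (hk1 : ∀ i a, k i a ≤ 1) : ∑ e, |(sieveCoeff e : ℝ)| * ∏ i, k i (e i) ≤ 54 := by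
  calc ∑ e, |(sieveCoeff e : ℝ)| * ∏ i, k i (e i) ≤ ∑ _e : Fin 3 → Fin 3, (2 : ℝ) := by
        refine Finset.sum_le_sum fun e _ => ?_
        have h1 : |(sieveCoeff e : ℝ)| ≤ 2 := by exact_mod_cast abs_sieveCoeff_le e
        have h2 : ∏ i, k i (e i) ≤ 1 := Finset.prod_le_one (fun i _ => hk0 _ _) fun i _ => hk1 _ _
        have h3 : 0 ≤ ∏ i, k i (e i) := Finset.prod_nonneg fun i _ => hk0 _ _
        nlinarith [abs_nonneg (sieveCoeff e : ℝ)]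
    _ = 54 := by simp; norm_num

/-- Each of the 27 exponent vectors other than 0 contributes at most 2z², since the linear
coefficients vanish. -/
theorem sum_abs_sieveCoeff_le_of_pow {z : ℝ} (hz0 : 0 ≤ z) (hz1 : z ≤ 1) :
    ∑ e, |(sieveCoeff e : ℝ)| * ∏ i, z ^ (e i : ℕ) ≤ 1 + 54 * z ^ 2 := by
  calc ∑ e, |(sieveCoeff e : ℝ)| * ∏ i, z ^ (e i : ℕ)
      ≤ ∑ e : Fin 3 → Fin 3, ((if e = 0 then 1 else 0) + 2 * z ^ 2) := by
        refine Finset.sum_le_sum fun e _ => ?_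
        rw [Finset.prod_pow_eq_pow_sum]
        have hz2 : 0 ≤ z ^ 2 := sq_nonneg z
        rcases sieveCoeff_eq_zero_or e with h | h | h
        · rw [h]
          simp only [Int.cast_zero, abs_zero, zero_mul]
          split_ifs <;> linarith
        · rw [h, sieveCoeff_zero]
          simp
          linarith
        · have h1 : |(sieveCoeff e : ℝ)| ≤ 2 := by exact_mod_cast abs_sieveCoeff_le e
          have h2 : z ^ (∑ i, (e i : ℕ)) ≤ z ^ 2 := pow_le_pow_of_le_one hz0 hz1 h
          have h3 : |(sieveCoeff e : ℝ)| * z ^ (∑ i, (e i : ℕ)) ≤ 2 * z ^ 2 :=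
            mul_le_mul h1 h2 (by positivity) (by norm_num)
          split_ifs <;> linarith
    _ = 1 + 54 * z ^ 2 := by
        rw [Finset.sum_add_distrib]
        simp
        ring

/-! ### An exact finite sieve for square-free products. -/

section
variable {F : Type*} [Field F] [Fintype F]

open Classical in
/-- The monic irreducible polynomials of degree at most `B`. -/
noncomputable def sievePrimes (F : Type*) [Field F] [Fintype F] (B : ℕ) : Finset F[X] :=
  ((Finset.range (B + 1)).biUnion (monicPolys F)).filter Irreducible

theorem mem_sievePrimes {B : ℕ} {P : F[X]} :
    P ∈ sievePrimes F B ↔ P.Monic ∧ Irreducible P ∧ P.natDegree ≤ B := by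
  classical
  simp only [sievePrimes, Finset.mem_filter, Finset.mem_biUnion, Finset.mem_range, mem_monicPolys]
  constructor
  · rintro ⟨⟨a, h1, h2, h3⟩, h4⟩
    exact ⟨h2, h4, by omega⟩
  · rintro ⟨h1, h2, h3⟩
    exact ⟨⟨_, by omega, h1, rfl⟩, h2⟩

theorem isCoprime_of_mem_sievePrimes {B : ℕ} {P Q : F[X]} (hP : P ∈ sievePrimes F B)
    (hQ : Q ∈ sievePrimes F B) (h : P ≠ Q) : IsCoprime P Q := by
  rw [mem_sievePrimes] at hP hQ
  rw [hP.2.1.coprime_iff_not_dvd]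
  intro hd
  exact h (eq_of_monic_of_associated hP.1 hQ.1 (hP.2.1.associated_of_dvd hQ.2.1 hd))

theorem squarefree_iff_forall_sievePrimes {f : F[X]} (hf : f ≠ 0) {B : ℕ}
    (hB : f.natDegree ≤ B) : Squarefree f ↔ ∀ P ∈ sievePrimes F B, ¬ P ^ 2 ∣ f := by
  constructor
  · intro h P hP hd
    rw [mem_sievePrimes] at hP
    exact hP.2.1.not_isUnit (h P (by rwa [← sq]))
  · intro h
    rw [squarefree_iff_irreducible_sq_not_dvd_of_ne_zero hf]
    intro P hP hd
    have hu : IsUnit (C P.leadingCoeff⁻¹) :=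
      isUnit_C.2 (isUnit_iff_ne_zero.2 (inv_ne_zero (leadingCoeff_ne_zero.2 hP.ne_zero)))
    have ha : Associated (P * C P.leadingCoeff⁻¹) P := (associated_mul_unit_left _ _ hu)
    have hm : (P * C P.leadingCoeff⁻¹).Monic := monic_mul_leadingCoeff_inv hP.ne_zero
    refine h (P * C P.leadingCoeff⁻¹) (mem_sievePrimes.2 ⟨hm, ha.symm.irreducible hP, ?_⟩) ?_
    · refine (natDegree_le_of_dvd ?_ hf).trans hB
      exact (dvd_trans ha.dvd (dvd_trans (dvd_mul_right P P) hd))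
    · rw [← sq] at hd
      exact ((ha.pow_pow (n := 2)).dvd).trans hd

theorem sq_dvd_prod_three_iff {K : Type*} [Field K] {P : K[X]} (hP : Irreducible P)
    (p : Fin 3 → K[X]) :
    P ^ 2 ∣ ∏ i, p i ↔ P ^ 2 ∣ p 0 ∨ P ^ 2 ∣ p 1 ∨ P ^ 2 ∣ p 2 ∨
      (P ∣ p 0 ∧ P ∣ p 1) ∨ (P ∣ p 0 ∧ P ∣ p 2) ∨ (P ∣ p 1 ∧ P ∣ p 2) := by
  rw [Fin.prod_univ_three]
  constructor
  · intro h
    by_contra! hn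
    obtain ⟨h0, h1, h2, h01, h02, h12⟩ := hn
    have key : ∀ a b c : K[X], ¬ P ∣ b → ¬ P ∣ c → P ^ 2 ∣ a * b * c → P ^ 2 ∣ a := by
      intro a b c hb hc habc
      have hb' : IsCoprime (P ^ 2) b := ((hP.coprime_iff_not_dvd).2 hb).pow_left
      have hc' : IsCoprime (P ^ 2) c := ((hP.coprime_iff_not_dvd).2 hc).pow_left
      exact hb'.dvd_of_dvd_mul_right (hc'.dvd_of_dvd_mul_right habc)
    by_cases d0 : P ∣ p 0
    · exact h0 (key _ _ _ (h01 d0) (h02 d0) h)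
    · by_cases d1 : P ∣ p 1
      · exact h1 (key _ _ _ d0 (h12 d1) (by rwa [mul_comm (p 1)]))
      · exact h2 (key _ _ _ d0 d1 (by rwa [mul_comm, ← mul_assoc] at h))
  · have hsq : ∀ a b : K[X], P ∣ a → P ∣ b → P ^ 2 ∣ a * b := fun a b ha hb => by
      rw [sq]; exact mul_dvd_mul ha hb
    rintro (h | h | h | ⟨h, h'⟩ | ⟨h, h'⟩ | ⟨h, h'⟩)
    · exact (h.mul_right _).mul_right _
    · exact (h.mul_left _).mul_right _
    · exact h.mul_left _
    · exact (hsq _ _ h h').mul_right _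
    · rw [mul_right_comm]; exact (hsq _ _ h h').mul_right _
    · rw [mul_assoc]; exact (hsq _ _ h h').mul_left _

open Classical in
-- P² does not divide the product exactly when P divides no factor (`j = none`) or divides exactly
-- one factor, exactly once (`j = some i`). These cases are mutually exclusive.
theorem sum_dvd_indicator_eq {K : Type*} [Field K] {P : K[X]} (hP : Irreducible P)
    (p : Fin 3 → K[X]) :
    (∑ j : Option (Fin 3), ∏ i, if j = some i then
        ((if P ^ 1 ∣ p i then (1 : ℝ) else 0) - if P ^ 2 ∣ p i then 1 else 0)
        else ((if P ^ 0 ∣ p i then (1 : ℝ) else 0) - if P ^ 1 ∣ p i then 1 else 0)) =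
      if P ^ 2 ∣ ∏ i, p i then 0 else 1 := by
  have hs : ∀ i, ¬ P ∣ p i ∧ ¬ P ^ 2 ∣ p i ∨ P ∣ p i ∧ ¬ P ^ 2 ∣ p i ∨ P ∣ p i ∧ P ^ 2 ∣ p i := by
    intro i
    have := fun h : P ^ 2 ∣ p i => (dvd_pow_self P two_ne_zero).trans h
    tauto
  rw [if_congr (sq_dvd_prod_three_iff hP p) rfl rfl]
  simp only [Fintype.sum_option, Fin.sum_univ_three, Fin.prod_univ_three, pow_one, pow_zero,
    one_dvd, if_true]
  rcases hs 0 with ⟨d0, s0⟩ | ⟨d0, s0⟩ | ⟨d0, s0⟩ <;>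
  rcases hs 1 with ⟨d1, s1⟩ | ⟨d1, s1⟩ | ⟨d1, s1⟩ <;>
  rcases hs 2 with ⟨d2, s2⟩ | ⟨d2, s2⟩ | ⟨d2, s2⟩ <;>
  simp [d0, d1, d2, s0, s1, s2]

open Classical in
/-- The triples of monic polynomials of degrees `d i` with square-free product. -/
noncomputable def sqfreeTriples (F : Type*) [Field F] [Fintype F] (d : Fin 3 → ℕ) :
    Finset (Fin 3 → F[X]) :=
  (Fintype.piFinset fun i => monicPolys F (d i)).filter fun p => Squarefree (∏ i, p i)

open Classical in
/-- The number of triples in `sqfreeTriples F d` with prescribed values. -/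
noncomputable def countValues (d : Fin 3 → ℕ) (r : F → Fin 3 → F) : ℕ :=
  ((sqfreeTriples F d).filter fun p => ∀ x i, (p i).eval x = r x i).card

/-- The modulus attached to a family of exponents. -/
noncomputable def sieveModulus {B : ℕ} (e : sievePrimes F B → Fin 3 → Fin 3) (i : Fin 3) : F[X] :=
  ∏ P : sievePrimes F B, (P : F[X]) ^ (e P i : ℕ)

theorem sieveModulus_dvd_iff {B : ℕ} (e : sievePrimes F B → Fin 3 → Fin 3) (i : Fin 3) (f : F[X]) :
    sieveModulus e i ∣ f ↔ ∀ P : sievePrimes F B, (P : F[X]) ^ (e P i : ℕ) ∣ f := by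
  rw [sieveModulus]
  constructor
  · intro h P
    exact (Finset.dvd_prod_of_mem (fun P : sievePrimes F B => (P : F[X]) ^ (e P i : ℕ))
      (Finset.mem_univ P)).trans h
  · intro h
    refine Finset.prod_dvd_of_coprime ?_ fun P _ => h P
    intro P _ Q _ hPQ
    exact (isCoprime_of_mem_sievePrimes P.2 Q.2 (fun h => hPQ (Subtype.ext h))).pow

theorem monic_sieveModulus {B : ℕ} (e : sievePrimes F B → Fin 3 → Fin 3) (i : Fin 3) :
    (sieveModulus e i).Monic := by
  rw [sieveModulus]
  exact monic_prod_of_monic _ _ fun P _ => (mem_sievePrimes.1 P.2).1.pow _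

open Classical in
-- The indicator of square-freeness is a product of local indicators over primes of degree at most
-- B, which suffice because B bounds the degree of the product. Expanding it gives a finite sum
-- without truncation error, and each term splits over the three coordinates.
theorem countValues_eq_sum (d : Fin 3 → ℕ) (r : F → Fin 3 → F) {B : ℕ} (hB : ∑ i, d i ≤ B) :
    (countValues d r : ℝ) = ∑ e : sievePrimes F B → Fin 3 → Fin 3,
      (∏ P, (sieveCoeff (e P) : ℝ)) *
        ∏ i, (countDvd (fun x => r x i) (d i) (sieveModulus e i) : ℝ) := by
  have hind : ∀ p ∈ Fintype.piFinset fun i => monicPolys F (d i),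
      (if Squarefree (∏ i, p i) then (1 : ℝ) else 0) = ∑ e : sievePrimes F B → Fin 3 → Fin 3,
        (∏ P, (sieveCoeff (e P) : ℝ)) * ∏ i, (if sieveModulus e i ∣ p i then (1 : ℝ) else 0) := by
    intro p hp
    rw [Fintype.mem_piFinset] at hp
    have hpm : (∏ i, p i).Monic := monic_prod_of_monic _ _ fun i _ => (mem_monicPolys.1 (hp i)).1
    have hpd : (∏ i, p i).natDegree ≤ B := by
      rw [natDegree_prod_of_monic _ _ fun i _ => (mem_monicPolys.1 (hp i)).1]
      simpa only [(mem_monicPolys.1 (hp _)).2] using hB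
    calc (if Squarefree (∏ i, p i) then (1 : ℝ) else 0)
        = ∏ P : sievePrimes F B, (if (P : F[X]) ^ 2 ∣ ∏ i, p i then (0 : ℝ) else 1) := by
          rw [squarefree_iff_forall_sievePrimes hpm.ne_zero hpd]
          split_ifs with h
          · rw [Finset.prod_eq_one]
            intro P _
            rw [if_neg (h P P.2)]
          · push Not at h
            obtain ⟨P, hP, hd⟩ := h
            rw [eq_comm, Finset.prod_eq_zero (Finset.mem_univ (⟨P, hP⟩ : sievePrimes F B))]
            rw [if_pos hd]
      _ = ∏ P : sievePrimes F B, ∑ e, (sieveCoeff e : ℝ) *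
            ∏ i, (if (P : F[X]) ^ (e i : ℕ) ∣ p i then (1 : ℝ) else 0) := by
          refine Finset.prod_congr rfl fun P _ => ?_
          rw [sum_sieveCoeff_mul_prod (fun i a => if (P : F[X]) ^ (a : ℕ) ∣ p i then (1 : ℝ) else 0)]
          exact (sum_dvd_indicator_eq (mem_sievePrimes.1 P.2).2.1 p).symm
      _ = _ := by
          rw [Fintype.prod_sum]
          refine Finset.sum_congr rfl fun e _ => ?_
          rw [Finset.prod_mul_distrib, Finset.prod_comm]
          congr 1
          refine Finset.prod_congr rfl fun i _ => ?_
          simp only [sieveModulus_dvd_iff]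
          rw [Finset.prod_ite_zero]
          simp
  calc (countValues d r : ℝ)
      = ∑ p ∈ Fintype.piFinset fun i => monicPolys F (d i),
          (if Squarefree (∏ i, p i) then (1 : ℝ) else 0) *
            ∏ i, (if ∀ x, (p i).eval x = r x i then (1 : ℝ) else 0) := by
        rw [countValues, sqfreeTriples, Finset.filter_filter, Finset.card_filter]
        push_cast
        refine Finset.sum_congr rfl fun p _ => ?_
        rw [Finset.prod_ite_zero]
        by_cases h : ∀ x i, (p i).eval x = r x i
        · have h' : ∀ i ∈ Finset.univ, ∀ x, (p i).eval x = r x i := fun i _ x => h x i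
          simp [h]
        · have h' : ¬ ∀ i ∈ Finset.univ, ∀ x, (p i).eval x = r x i :=
            fun h' => h fun x i => h' i (Finset.mem_univ _) x
          rw [if_neg h', if_neg (fun hh => h hh.2), mul_zero]
    _ = ∑ p ∈ Fintype.piFinset fun i => monicPolys F (d i), ∑ e : sievePrimes F B → Fin 3 → Fin 3,
          (∏ P, (sieveCoeff (e P) : ℝ)) *
            ∏ i, (if (∀ x, (p i).eval x = r x i) ∧ sieveModulus e i ∣ p i then (1 : ℝ) else 0) := by
        refine Finset.sum_congr rfl fun p hp => ?_
        rw [hind p hp, Finset.sum_mul]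
        refine Finset.sum_congr rfl fun e _ => ?_
        rw [mul_assoc, ← Finset.prod_mul_distrib]
        congr 1
        refine Finset.prod_congr rfl fun i _ => ?_
        rw [ite_and]
        split_ifs <;> simp
    _ = _ := by
        rw [Finset.sum_comm]
        refine Finset.sum_congr rfl fun e _ => ?_
        rw [← Finset.mul_sum]
        congr 1
        have := Finset.prod_univ_sum (fun i => monicPolys F (d i)) (fun i f =>
          if (∀ x, f.eval x = r x i) ∧ sieveModulus e i ∣ f then (1 : ℝ) else 0)
        rw [← this]
        refine Finset.prod_congr rfl fun i _ => ?_
        rw [countDvd, Finset.card_filter]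
        push_cast
        rfl
end

/-! ### Euler products and the absolute error of the sieve. -/

section
variable {F : Type*} [Field F] [Fintype F]

/-- The primes are replaced by all monic polynomials, q^k in degree k, which gives a geometric
series. -/
theorem sum_sievePrimes_pow_le (B : ℕ) {z y : ℝ} (hz : 0 ≤ z) (hzy : Fintype.card F * z ≤ y)
    (hy : y < 1) : ∑ P ∈ sievePrimes F B, z ^ P.natDegree ≤ 1 / (1 - y) := by
  classical
  calc ∑ P ∈ sievePrimes F B, z ^ P.natDegree
      ≤ ∑ P ∈ (Finset.range (B + 1)).biUnion (monicPolys F), z ^ P.natDegree :=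
        Finset.sum_le_sum_of_subset_of_nonneg
          (fun P hP => (Finset.mem_filter.1 hP).1) fun _ _ _ => by positivity
    _ = ∑ k ∈ Finset.range (B + 1), ∑ P ∈ monicPolys F k, z ^ P.natDegree := by
        refine Finset.sum_biUnion ?_
        intro k _ l _ hkl
        rw [Function.onFun, Finset.disjoint_left]
        intro f hf hf'
        rw [mem_monicPolys] at hf hf'
        exact hkl (hf.2.symm.trans hf'.2)
    _ = ∑ k ∈ Finset.range (B + 1), (Fintype.card F * z) ^ k := by
        refine Finset.sum_congr rfl fun k _ => ?_
        rw [Finset.sum_congr rfl fun P hP => by rw [(mem_monicPolys.1 hP).2], Finset.sum_const,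
          card_monicPolys, nsmul_eq_mul, mul_pow]
        push_cast
        rfl
    _ ≤ ∑ k ∈ Finset.range (B + 1), y ^ k :=
        Finset.sum_le_sum fun k _ => pow_le_pow_left₀ (by positivity) hzy k
    _ ≤ 1 / (1 - y) := by
        have hy0 : 0 ≤ y := le_trans (by positivity) hzy
        rw [one_div, ← tsum_geometric_of_lt_one hy0 hy]
        exact (summable_geometric_of_lt_one hy0 hy).sum_le_tsum _ fun _ _ => by positivity

/-- The contribution of a nonlinear prime of norm `Q` to the density of `sqfreeTriples`. -/
noncomputable def localFactor (Q : ℝ) : ℝ := (1 + 3 / Q) * (1 - 1 / Q) ^ 3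

open Classical in
/-- The monic irreducible polynomials of degree at most `B` without roots. -/
noncomputable def rootlessPrimes (F : Type*) [Field F] [Fintype F] (B : ℕ) : Finset F[X] :=
  (sievePrimes F B).filter fun P => ¬ ∃ x, P.eval x = 0

theorem mem_rootlessPrimes {B : ℕ} {P : F[X]} :
    P ∈ rootlessPrimes F B ↔ P ∈ sievePrimes F B ∧ ¬ ∃ x, P.eval x = 0 := by
  simp [rootlessPrimes]

theorem rootlessPrimes_subset (B : ℕ) : rootlessPrimes F B ⊆ sievePrimes F B :=
  fun _ hP => (mem_rootlessPrimes.1 hP).1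

/-- The contribution of the nonlinear primes to the density of `sqfreeTriples`. -/
noncomputable def sieveConst (F : Type*) [Field F] [Fintype F] (B : ℕ) : ℝ :=
  ∏ P ∈ rootlessPrimes F B,
    localFactor ((Fintype.card F : ℝ) ^ P.natDegree)

/-- With t = 1/Q the factor is 1 - 6t² + 8t³ - 3t⁴ ≥ 1 - 6t², and t² ≤ 1/16 makes this at least
exp(-12t²). -/
theorem exp_neg_le_localFactor {Q : ℝ} (hQ : 4 ≤ Q) :
    Real.exp (-(12 * (1 / Q) ^ 2)) ≤ localFactor Q := by
  set t := 1 / Q with ht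
  have ht0 : 0 < t := by positivity
  have ht1 : t ≤ 1 / 4 := one_div_le_one_div_of_le (by norm_num) hQ
  have h1 : 1 - 6 * t ^ 2 ≤ localFactor Q := by
    rw [localFactor, show 3 / Q = 3 * t by rw [ht]; ring, ← ht]
    nlinarith [pow_pos ht0 3]
  have h2 : 1 + 12 * t ^ 2 ≤ Real.exp (12 * t ^ 2) := by
    linarith [Real.add_one_le_exp (12 * t ^ 2)]
  have h3 : 1 ≤ (1 - 6 * t ^ 2) * Real.exp (12 * t ^ 2) := by
    have : t ^ 2 ≤ 1 / 16 := by nlinarith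
    nlinarith [sq_nonneg t]
  rw [Real.exp_neg]
  refine le_trans ?_ h1
  rw [inv_le_iff_one_le_mul₀ (Real.exp_pos _)]
  exact h3

theorem two_le_natDegree_of_no_root {B : ℕ} {P : F[X]} (hP : P ∈ sievePrimes F B)
    (hr : ¬ ∃ x, P.eval x = 0) : 2 ≤ P.natDegree := by
  rw [mem_sievePrimes] at hP
  by_contra! h
  have h0 := hP.2.1.natDegree_pos
  have h1 : P.degree = 1 := by
    rw [degree_eq_natDegree hP.1.ne_zero, show P.natDegree = 1 by omega]; rfl
  obtain ⟨x, hx⟩ := exists_root_of_degree_eq_one h1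
  exact hr ⟨x, hx⟩

/-- The sum of Q^(-2) over the primes is at most 2, and 24 = 12 · 2. The bound is uniform in the
field and in B. -/
theorem exp_neg_le_sieveConst (B : ℕ) : Real.exp (-24) ≤ sieveConst F B := by
  classical
  have hq : (2 : ℝ) ≤ Fintype.card F := by exact_mod_cast Fintype.one_lt_card (α := F)
  have hQ : ∀ P ∈ rootlessPrimes F B,
      4 ≤ (Fintype.card F : ℝ) ^ P.natDegree := by
    intro P hP
    rw [mem_rootlessPrimes] at hP
    calc (4 : ℝ) ≤ (Fintype.card F : ℝ) ^ 2 := by nlinarith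
      _ ≤ _ := pow_le_pow_right₀ (by linarith) (two_le_natDegree_of_no_root hP.1 hP.2)
  have hsum : ∑ P ∈ rootlessPrimes F B,
      (1 / (Fintype.card F : ℝ) ^ P.natDegree) ^ 2 ≤ 2 := by
    calc _ ≤ ∑ P ∈ sievePrimes F B, (1 / (Fintype.card F : ℝ) ^ P.natDegree) ^ 2 :=
          Finset.sum_le_sum_of_subset_of_nonneg (rootlessPrimes_subset B)
            fun _ _ _ => by positivity
      _ = ∑ P ∈ sievePrimes F B, ((1 / (Fintype.card F : ℝ)) ^ 2) ^ P.natDegree := by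
          refine Finset.sum_congr rfl fun P _ => ?_
          rw [← pow_mul, ← one_div_pow, ← pow_mul, mul_comm]
      _ ≤ 1 / (1 - 1 / 2) := by
          refine sum_sievePrimes_pow_le B (by positivity) ?_ (by norm_num)
          rw [div_pow, one_pow, mul_one_div, div_le_div_iff₀ (by positivity) (by norm_num)]
          nlinarith
      _ = 2 := by norm_num
  calc Real.exp (-24)
      ≤ Real.exp (∑ P ∈ rootlessPrimes F B,
          -(12 * (1 / (Fintype.card F : ℝ) ^ P.natDegree) ^ 2)) := by
        apply Real.exp_le_exp.2
        rw [Finset.sum_neg_distrib, ← Finset.mul_sum]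
        linarith
    _ = ∏ P ∈ rootlessPrimes F B,
          Real.exp (-(12 * (1 / (Fintype.card F : ℝ) ^ P.natDegree) ^ 2)) := Real.exp_sum _ _
    _ ≤ sieveConst F B :=
        Finset.prod_le_prod (fun _ _ => (Real.exp_pos _).le)
          fun P hP => exp_neg_le_localFactor (hQ P hP)

open Classical in
/-- The relative frequency of the value triple `ρ` at a point: `0` if two values vanish. -/
noncomputable def localWeight (ρ : Fin 3 → F) : ℝ :=
  ∑ j : Option (Fin 3), ∏ i, if j = some i then
    (if ρ i = 0 then 1 - 1 / (Fintype.card F : ℝ) else 0) else (if ρ i = 0 then 0 else 1)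

theorem sum_sieveCoeff_mul_dvdDensity_of_no_root (r : F → Fin 3 → F) {P : F[X]}
    (hP : ¬ ∃ x, P.eval x = 0) :
    ∑ e, (sieveCoeff e : ℝ) * ∏ i, dvdDensity (fun x => r x i) (P ^ (e i : ℕ)) =
      localFactor ((Fintype.card F : ℝ) ^ P.natDegree) := by
  push Not at hP
  rw [sum_sieveCoeff_mul_prod (fun i a => dvdDensity (fun x => r x i) (P ^ (a : ℕ)))]
  simp only [dvdDensity_pow_of_forall_eval_ne_zero _ hP, Fintype.sum_option, Fin.sum_univ_three,
    Fin.prod_univ_three, localFactor]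
  simp
  ring

theorem sum_sieveCoeff_mul_dvdDensity_X_sub_C (r : F → Fin 3 → F) (x : F) :
    ∑ e, (sieveCoeff e : ℝ) * ∏ i, dvdDensity (fun x => r x i) ((X - C x) ^ (e i : ℕ)) =
      localWeight (r x) := by
  classical
  rw [sum_sieveCoeff_mul_prod (fun i a => dvdDensity (fun x => r x i) ((X - C x) ^ (a : ℕ))),
    localWeight]
  have h1 : ∀ i, dvdDensity (fun x => r x i) ((X - C x) ^ ((1 : Fin 3) : ℕ)) =
      if r x i = 0 then 1 else 0 := fun i => by
    simpa using dvdDensity_X_sub_C_pow (fun x => r x i) x 0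
  have h2 : ∀ i, dvdDensity (fun x => r x i) ((X - C x) ^ ((2 : Fin 3) : ℕ)) =
      if r x i = 0 then 1 / (Fintype.card F : ℝ) else 0 := fun i => by
    simpa using dvdDensity_X_sub_C_pow (fun x => r x i) x 1
  have h0 : ∀ i, dvdDensity (fun x => r x i) ((X - C x) ^ ((0 : Fin 3) : ℕ)) = 1 := fun i => by
    simpa using dvdDensity_one (fun x => r x i)
  refine Finset.sum_congr rfl fun j _ => Finset.prod_congr rfl fun i _ => ?_
  rw [h0, h1, h2]
  split_ifs <;> simp

theorem prod_sievePrimes_eq {B : ℕ} (hB : 1 ≤ B) (f : F[X] → ℝ) :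
    (∏ P : sievePrimes F B, f P) = (∏ x, f (X - C x)) *
      ∏ P ∈ rootlessPrimes F B, f P := by
  classical
  rw [Finset.prod_coe_sort (sievePrimes F B) f,
    ← Finset.prod_filter_mul_prod_filter_not (sievePrimes F B) (fun P => ∃ x, P.eval x = 0)]
  rw [rootlessPrimes]
  congr 1
  symm
  refine Finset.prod_bij (fun x _ => X - C x) ?_ ?_ ?_ fun _ _ => rfl
  · intro x _
    rw [Finset.mem_filter, mem_sievePrimes]
    exact ⟨⟨monic_X_sub_C x, irreducible_X_sub_C x, by rw [natDegree_X_sub_C]; exact hB⟩, x, by simp⟩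
  · intro x _ y _ h
    exact C_injective (sub_right_injective h)
  · intro P hP
    rw [Finset.mem_filter, mem_sievePrimes] at hP
    obtain ⟨⟨h1, h2, -⟩, x, hx⟩ := hP
    refine ⟨x, Finset.mem_univ _, ?_⟩
    exact eq_of_monic_of_associated (monic_X_sub_C x) h1
      ((irreducible_X_sub_C x).associated_of_dvd h2 (dvd_iff_isRoot.2 hx))

/-- Telescoping: one factor is exchanged at a time, the others being bounded by `w`. -/
theorem abs_prod_three_sub_le {a b w : Fin 3 → ℝ} {x : ℝ} (ha0 : ∀ i, 0 ≤ a i)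
    (hb0 : ∀ i, 0 ≤ b i) (ha : ∀ i, a i ≤ w i) (hb : ∀ i, b i ≤ w i)
    (hx : ∀ i, |a i - b i| ≤ x * w i) :
    |∏ i, a i - ∏ i, b i| ≤ 3 * x * ∏ i, w i := by
  simp only [Fin.prod_univ_three]
  have hw : ∀ i, 0 ≤ w i := fun i => (ha0 i).trans (ha i)
  have e : a 0 * a 1 * a 2 - b 0 * b 1 * b 2 = (a 0 - b 0) * (a 1 * a 2) +
      (a 1 - b 1) * (b 0 * a 2) + (a 2 - b 2) * (b 0 * b 1) := by ring
  have k : ∀ i s t u v, 0 ≤ s → 0 ≤ t → s ≤ u → t ≤ v →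
      |(a i - b i) * (s * t)| ≤ (x * w i) * (u * v) := by
    intro i s t u v hs ht hsu htv
    rw [abs_mul, abs_of_nonneg (mul_nonneg hs ht)]
    exact mul_le_mul (hx i) (mul_le_mul hsu htv ht (hs.trans hsu)) (mul_nonneg hs ht)
      ((abs_nonneg _).trans (hx i))
  rw [e]
  refine (abs_add_three _ _ _).trans ?_
  have k0 := k 0 _ _ _ _ (ha0 1) (ha0 2) (ha 1) (ha 2)
  have k1 := k 1 _ _ _ _ (hb0 0) (ha0 2) (hb 0) (ha 2)
  have k2 := k 2 _ _ _ _ (hb0 0) (hb0 1) (hb 0) (hb 1)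
  linarith

theorem dvdDensity_sieveModulus {B : ℕ} (e : sievePrimes F B → Fin 3 → Fin 3) (i : Fin 3)
    (r : F → F) : dvdDensity r (sieveModulus e i) =
      ∏ P : sievePrimes F B, dvdDensity r ((P : F[X]) ^ (e P i : ℕ)) := by
  rw [sieveModulus]
  refine dvdDensity_prod _ _ _ (fun P _ => ((mem_sievePrimes.1 P.2).1.pow _).ne_zero) ?_
  intro P _ Q _ hPQ
  exact (isCoprime_of_mem_sievePrimes P.2 Q.2 (fun h => hPQ (Subtype.ext h))).pow

theorem dvdDensity_le_one (r : F → F) {A : F[X]} (hA : A ≠ 0) : dvdDensity r A ≤ 1 := by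
  unfold dvdDensity
  split_ifs
  · exact div_le_one_of_le₀ (pow_le_pow_right₀ one_lt_card_real.le (card_zeroSet_le hA))
      (by positivity)
  · exact zero_le_one

/-- At a linear prime the density need not decay, since it is 1 for the first power when the value
vanishes; the trivial bound 54 is used and costs 54^q. At a prime of norm Q without roots, z =
Q^(θ-1) gives 1 + 54z², and the sum of z² over these primes is finite because θ < 1/2. -/
theorem sum_abs_sieveCoeff_mul_dvdDensity_le (r : F → Fin 3 → F) {B : ℕ} (hB : 1 ≤ B) {θ : ℝ}
    (hθ1 : θ < 1 / 2) :
    ∏ P : sievePrimes F B, ∑ e : Fin 3 → Fin 3, |(sieveCoeff e : ℝ)| *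
        ∏ i, dvdDensity (fun x => r x i) ((P : F[X]) ^ (e i : ℕ)) ^ (1 - θ) ≤
      54 ^ Fintype.card F * Real.exp (54 * (1 / (1 - (2 : ℝ) ^ (2 * θ - 1)))) := by
  classical
  have hq : (2 : ℝ) ≤ Fintype.card F := by exact_mod_cast Fintype.one_lt_card (α := F)
  have hq0 : (0 : ℝ) < Fintype.card F := by linarith
  have hnn : ∀ P : F[X], 0 ≤ ∑ e : Fin 3 → Fin 3, |(sieveCoeff e : ℝ)| *
        ∏ i, dvdDensity (fun x => r x i) (P ^ (e i : ℕ)) ^ (1 - θ) := fun P =>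
    Finset.sum_nonneg fun e _ => mul_nonneg (abs_nonneg _)
      (Finset.prod_nonneg fun i _ => Real.rpow_nonneg (dvdDensity_nonneg _ _) _)
  rw [prod_sievePrimes_eq hB (fun P => ∑ e : Fin 3 → Fin 3, |(sieveCoeff e : ℝ)| *
        ∏ i, dvdDensity (fun x => r x i) (P ^ (e i : ℕ)) ^ (1 - θ))]
  refine mul_le_mul ?_ ?_ (Finset.prod_nonneg fun P _ => hnn P) (by positivity)
  · rw [← Finset.card_univ, ← Finset.prod_const]
    refine Finset.prod_le_prod (fun x _ => hnn _) fun x _ => ?_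
    refine sum_abs_sieveCoeff_le_of_le_one
      (fun i a => dvdDensity (fun x => r x i) ((X - C x) ^ (a : ℕ)) ^ (1 - θ)) ?_ ?_
    · exact fun i a => Real.rpow_nonneg (dvdDensity_nonneg _ _) _
    · exact fun i a => Real.rpow_le_one (dvdDensity_nonneg _ _)
        (dvdDensity_le_one _ ((monic_X_sub_C x).pow _).ne_zero) (by linarith)
  · have hlocal : ∀ P ∈ rootlessPrimes F B,
        ∑ e : Fin 3 → Fin 3, |(sieveCoeff e : ℝ)| *
          ∏ i, dvdDensity (fun x => r x i) (P ^ (e i : ℕ)) ^ (1 - θ) ≤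
        Real.exp (54 * ((Fintype.card F : ℝ) ^ (2 * θ - 2)) ^ P.natDegree) := by
      intro P hP
      rw [mem_rootlessPrimes, not_exists] at hP
      set Q := (Fintype.card F : ℝ) ^ P.natDegree with hQ
      have hQ1 : 1 ≤ Q := one_le_pow₀ (by linarith)
      have hQ0 : 0 < Q := by linarith
      have h1 : ∀ i a, dvdDensity (fun x => r x i) (P ^ a) ^ (1 - θ) =
          (Q ^ (θ - 1)) ^ a := by
        intro i a
        rw [dvdDensity_pow_of_forall_eval_ne_zero _ hP.2, ← hQ, one_div, Real.inv_rpow (by positivity),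
          ← Real.rpow_neg (by positivity), neg_sub, ← Real.rpow_natCast Q, ← Real.rpow_mul hQ0.le,
          ← Real.rpow_natCast, ← Real.rpow_mul hQ0.le, mul_comm]
      simp only [h1]
      refine (sum_abs_sieveCoeff_le_of_pow (by positivity)
        (Real.rpow_le_one_of_one_le_of_nonpos hQ1 (by linarith))).trans ?_
      have h2 : (Q ^ (θ - 1)) ^ 2 = ((Fintype.card F : ℝ) ^ (2 * θ - 2)) ^ P.natDegree := by
        rw [hQ, ← Real.rpow_natCast, ← Real.rpow_natCast, ← Real.rpow_natCast,
          ← Real.rpow_mul hq0.le, ← Real.rpow_mul hq0.le, ← Real.rpow_mul hq0.le]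
        congr 1
        push_cast
        ring
      rw [h2, add_comm]
      exact Real.add_one_le_exp _
    refine (Finset.prod_le_prod (fun P _ => hnn P) hlocal).trans ?_
    rw [← Real.exp_sum, Real.exp_le_exp, ← Finset.mul_sum]
    refine mul_le_mul_of_nonneg_left ?_ (by norm_num)
    refine (Finset.sum_le_sum_of_subset_of_nonneg (rootlessPrimes_subset B)
      fun _ _ _ => by positivity).trans ?_
    refine sum_sievePrimes_pow_le B (by positivity) ?_ ?_
    · calc (Fintype.card F : ℝ) * (Fintype.card F : ℝ) ^ (2 * θ - 2)
          = (Fintype.card F : ℝ) ^ (2 * θ - 1) := by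
            rw [← Real.rpow_one_add' hq0.le (by linarith)]
            congr 1; ring
        -- The exponent is negative, so q ≥ 2 makes the bound independent of the field.
        _ ≤ (2 : ℝ) ^ (2 * θ - 1) :=
            Real.rpow_le_rpow_of_nonpos (by norm_num) hq (by linarith)
    · exact Real.rpow_lt_one_of_one_lt_of_neg (by norm_num) (by linarith)

/-- The main term is the same sieve sum with densities in place of normalised counts, so the two are
compared term by term. -/
theorem abs_countValues_sub_le (d : Fin 3 → ℕ) (r : F → Fin 3 → F) {B : ℕ}
    (hB : ∑ i, d i ≤ B) (hB1 : 1 ≤ B) {θ m : ℝ} (hθ0 : 0 < θ) (hθ1 : θ < 1 / 2)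
    (hm : ∀ i, m ≤ d i) (hq : (Fintype.card F : ℝ) ≤ θ * m) :
    |(countValues d r : ℝ) / (∏ i, (Fintype.card F : ℝ) ^ ((d i : ℝ) - Fintype.card F)) -
        sieveConst F B * ∏ x, localWeight (r x)| ≤
      3 * (Fintype.card F : ℝ) ^ ((Fintype.card F : ℝ) - θ * m) *
        (54 ^ Fintype.card F * Real.exp (54 * (1 / (1 - (2 : ℝ) ^ (2 * θ - 1))))) := by
  classical
  have hmain : sieveConst F B * ∏ x, localWeight (r x) =
      ∑ e : sievePrimes F B → Fin 3 → Fin 3, (∏ P, (sieveCoeff (e P) : ℝ)) *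
        ∏ i, dvdDensity (fun x => r x i) (sieveModulus e i) := by
    calc sieveConst F B * ∏ x, localWeight (r x)
        = ∏ P : sievePrimes F B, ∑ e, (sieveCoeff e : ℝ) *
            ∏ i, dvdDensity (fun x => r x i) ((P : F[X]) ^ (e i : ℕ)) := by
          rw [prod_sievePrimes_eq hB1 (fun P => ∑ e, (sieveCoeff e : ℝ) *
            ∏ i, dvdDensity (fun x => r x i) (P ^ (e i : ℕ))), mul_comm, sieveConst]
          congr 1
          · exact Finset.prod_congr rfl fun x _ =>
              (sum_sieveCoeff_mul_dvdDensity_X_sub_C r x).symm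
          · exact Finset.prod_congr rfl fun P hP =>
              (sum_sieveCoeff_mul_dvdDensity_of_no_root r (mem_rootlessPrimes.1 hP).2).symm
      _ = _ := by
          rw [Fintype.prod_sum]
          refine Finset.sum_congr rfl fun e _ => ?_
          simp only [dvdDensity_sieveModulus]
          rw [Finset.prod_mul_distrib, Finset.prod_comm]
  rw [countValues_eq_sum d r hB, hmain, Finset.sum_div, ← Finset.sum_sub_distrib]
  calc _ ≤ ∑ e : sievePrimes F B → Fin 3 → Fin 3, (∏ P, |(sieveCoeff (e P) : ℝ)|) *
          (3 * (Fintype.card F : ℝ) ^ ((Fintype.card F : ℝ) - θ * m) *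
            ∏ i, dvdDensity (fun x => r x i) (sieveModulus e i) ^ (1 - θ)) := by
        refine (Finset.abs_sum_le_sum_abs _ _).trans (Finset.sum_le_sum fun e _ => ?_)
        rw [mul_div_assoc, ← mul_sub, abs_mul, Finset.abs_prod, ← Finset.prod_div_distrib]
        refine mul_le_mul_of_nonneg_left ?_ (Finset.prod_nonneg fun _ _ => abs_nonneg _)
        have h := fun i => abs_countDvd_sub_le (r := fun x => r x i) (n := d i)
          (monic_sieveModulus e i) hθ0 (by linarith) (hm i) hq
        exact abs_prod_three_sub_le (fun i => by positivity) (fun i => dvdDensity_nonneg _ _)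
          (fun i => (h i).2.1) (fun i => (h i).1) (fun i => (h i).2.2)
    _ = 3 * (Fintype.card F : ℝ) ^ ((Fintype.card F : ℝ) - θ * m) *
        ∏ P : sievePrimes F B, ∑ e : Fin 3 → Fin 3, |(sieveCoeff e : ℝ)| *
          ∏ i, dvdDensity (fun x => r x i) ((P : F[X]) ^ (e i : ℕ)) ^ (1 - θ) := by
        rw [Fintype.prod_sum, Finset.mul_sum]
        refine Finset.sum_congr rfl fun e _ => ?_
        simp only [dvdDensity_sieveModulus]
        rw [Finset.prod_mul_distrib, Finset.prod_comm]
        simp only [← Real.finsetProd_rpow _ _ fun P _ => dvdDensity_nonneg _ _]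
        ring
    _ ≤ _ := mul_le_mul_of_nonneg_left (sum_abs_sieveCoeff_mul_dvdDensity_le r hB1 hθ1)
        (by positivity)
end

/-! ### The relative error for prescribed values. -/

section
variable {F : Type*} [Field F] [Fintype F]

theorem localWeight_eq_zero_or (ρ : Fin 3 → F) :
    1 / 2 ≤ localWeight ρ ∨ localWeight ρ = 0 ∧ ∃ i j, i ≠ j ∧ ρ i = 0 ∧ ρ j = 0 := by
  have hq : (2 : ℝ) ≤ Fintype.card F := by exact_mod_cast Fintype.one_lt_card (α := F)
  have hinv : 1 / (Fintype.card F : ℝ) ≤ 1 / 2 := one_div_le_one_div_of_le (by norm_num) hq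
  simp only [localWeight, Fintype.sum_option, Fin.sum_univ_three, Fin.prod_univ_three]
  by_cases h0 : ρ 0 = 0
  · by_cases h1 : ρ 1 = 0
    · exact .inr ⟨by simp [h0, h1], 0, 1, by decide, h0, h1⟩
    · by_cases h2 : ρ 2 = 0
      · exact .inr ⟨by simp [h0, h2], 0, 2, by decide, h0, h2⟩
      · left; simp [h0, h1, h2] at hinv ⊢; linarith
  · by_cases h1 : ρ 1 = 0
    · by_cases h2 : ρ 2 = 0
      · exact .inr ⟨by simp [h1, h2], 1, 2, by decide, h1, h2⟩
      · left; simp [h0, h1, h2] at hinv ⊢; linarith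
    · left
      by_cases h2 : ρ 2 = 0
      · simp [h0, h1, h2] at hinv ⊢; linarith
      · simp [h0, h1, h2]; norm_num

theorem countValues_eq_zero {d : Fin 3 → ℕ} {r : F → Fin 3 → F} {x : F} {i j : Fin 3}
    (hij : i ≠ j) (hi : r x i = 0) (hj : r x j = 0) : countValues d r = 0 := by
  classical
  rw [countValues, Finset.card_eq_zero, Finset.filter_eq_empty_iff]
  intro p hp h
  rw [sqfreeTriples, Finset.mem_filter] at hp
  have h1 : (X - C x) ∣ p i := dvd_iff_isRoot.2 ((h x i).trans hi)
  have h2 : (X - C x) ∣ p j := dvd_iff_isRoot.2 ((h x j).trans hj)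
  have h3 : (X - C x) * (X - C x) ∣ ∏ k, p k := by
    rw [← Finset.mul_prod_erase _ _ (Finset.mem_univ i)]
    exact mul_dvd_mul h1 (h2.trans (Finset.dvd_prod_of_mem _ (by simp [hij.symm])))
  exact (irreducible_X_sub_C x).not_isUnit (hp.2 _ h3)

/-- The constant in the error term for `countValues`. -/
noncomputable def sieveErrorConst (θ : ℝ) : ℝ :=
  3 * Real.exp (54 * (1 / (1 - (2 : ℝ) ^ (2 * θ - 1)))) * Real.exp 24

theorem one_le_sieveErrorConst {θ : ℝ} (hθ1 : θ < 1 / 2) : 1 ≤ sieveErrorConst θ := by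
  have h : (2 : ℝ) ^ (2 * θ - 1) < 1 :=
    Real.rpow_lt_one_of_one_lt_of_neg (by norm_num) (by linarith)
  have h1 : 1 ≤ Real.exp (54 * (1 / (1 - (2 : ℝ) ^ (2 * θ - 1)))) := by
    rw [Real.one_le_exp_iff]
    have : 0 < 1 - (2 : ℝ) ^ (2 * θ - 1) := by linarith
    positivity
  have h2 : 1 ≤ Real.exp 24 := Real.one_le_exp_iff.2 (by norm_num)
  rw [sieveErrorConst]
  nlinarith

/-- If no two values vanish at a common point, every local weight is at least 1/2 and the density is
at least e^(-24) 2^(-q); dividing by it turns 54^q into 108^q. Otherwise count and main term both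
vanish. -/
theorem abs_countValues_sub_le_mul (d : Fin 3 → ℕ) (r : F → Fin 3 → F) {B : ℕ}
    (hB : ∑ i, d i ≤ B) (hB1 : 1 ≤ B) {θ m : ℝ} (hθ0 : 0 < θ) (hθ1 : θ < 1 / 2)
    (hm : ∀ i, m ≤ d i) (hq : (Fintype.card F : ℝ) ≤ θ * m) :
    |(countValues d r : ℝ) - (∏ i, (Fintype.card F : ℝ) ^ ((d i : ℝ) - Fintype.card F)) *
        (sieveConst F B * ∏ x, localWeight (r x))| ≤
      (sieveErrorConst θ * 108 ^ Fintype.card F *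
        (Fintype.card F : ℝ) ^ ((Fintype.card F : ℝ) - θ * m)) *
      ((∏ i, (Fintype.card F : ℝ) ^ ((d i : ℝ) - Fintype.card F)) *
        (sieveConst F B * ∏ x, localWeight (r x))) := by
  set N := ∏ i, (Fintype.card F : ℝ) ^ ((d i : ℝ) - Fintype.card F) with hN
  have hq0 : (0 : ℝ) < Fintype.card F := by linarith [one_lt_card_real (F := F)]
  have hN0 : 0 < N := Finset.prod_pos fun i _ => by positivity
  by_cases hr : ∀ x, 1 / 2 ≤ localWeight (r x)
  · have h := abs_countValues_sub_le d r hB hB1 hθ0 hθ1 hm hq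
    rw [← hN] at h
    have hw : (1 / 2 : ℝ) ^ Fintype.card F ≤ ∏ x, localWeight (r x) := by
      rw [← Finset.card_univ, ← Finset.prod_const]
      exact Finset.prod_le_prod (fun _ _ => by norm_num) fun x _ => hr x
    have hK := exp_neg_le_sieveConst (F := F) B
    have hKw : Real.exp (-24) * (1 / 2 : ℝ) ^ Fintype.card F ≤
        sieveConst F B * ∏ x, localWeight (r x) :=
      mul_le_mul hK hw (by positivity) ((Real.exp_pos _).le.trans hK)
    have h1 : 1 ≤ Real.exp 24 * 2 ^ Fintype.card F * (sieveConst F B * ∏ x, localWeight (r x)) := by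
      calc (1 : ℝ) = Real.exp 24 * 2 ^ Fintype.card F *
            (Real.exp (-24) * (1 / 2 : ℝ) ^ Fintype.card F) := by
            rw [Real.exp_neg, one_div, inv_pow]
            field_simp
        _ ≤ _ := mul_le_mul_of_nonneg_left hKw (by positivity)
    set κ := sieveConst F B * ∏ x, localWeight (r x) with hκ
    have e1 : (countValues d r : ℝ) - N * κ = N * ((countValues d r : ℝ) / N - κ) := by
      field_simp
    rw [e1, abs_mul, abs_of_pos hN0, mul_left_comm]
    refine mul_le_mul_of_nonneg_left (h.trans ?_) hN0.le
    rw [sieveErrorConst, show (108 : ℝ) = 54 * 2 by norm_num, mul_pow]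
    set E := Real.exp (54 * (1 / (1 - (2 : ℝ) ^ (2 * θ - 1))))
    set x := (Fintype.card F : ℝ) ^ ((Fintype.card F : ℝ) - θ * m)
    calc 3 * x * (54 ^ Fintype.card F * E)
        ≤ 3 * x * (54 ^ Fintype.card F * E) * (Real.exp 24 * 2 ^ Fintype.card F * κ) :=
          le_mul_of_one_le_right (by positivity) h1
      _ = _ := by ring
  · push Not at hr
    obtain ⟨x, hx⟩ := hr
    rcases localWeight_eq_zero_or (r x) with h | ⟨h, i, j, hij, hi, hj⟩
    · linarith
    · rw [countValues_eq_zero hij hi hj, Finset.prod_eq_zero (Finset.mem_univ x) h]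
      simp

/-! ### The law of the contribution of an affine point. -/

section Characters
variable [DecidableEq F]

theorem sum_quadraticChar_comp (hF : ringChar F ≠ 2) (G : ℤ → ℝ) {u : F} (hu : u ≠ 0) :
    ∑ a : F, G (quadraticChar F (u * a)) =
      G 0 + ((Fintype.card F : ℝ) - 1) / 2 * (G 1 + G (-1)) := by
  have hbij : ∑ a : F, G (quadraticChar F (u * a)) = ∑ a : F, G (quadraticChar F a) :=
    Fintype.sum_equiv (Equiv.mulLeft₀ u hu) _ _ fun _ => rfl
  have h1 : ∑ a : F, (quadraticChar F a : ℝ) = 0 := by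
    exact_mod_cast quadraticChar_sum_zero hF
  have h2 : ∑ a : F, ((quadraticChar F a : ℝ)) ^ 2 = (Fintype.card F : ℝ) - 1 := by
    have : ∀ a : F, ((quadraticChar F a : ℝ)) ^ 2 = 1 - if a = 0 then 1 else 0 := by
      intro a
      split_ifs with h
      · simp [h]
      · have := quadraticChar_sq_one h
        rw [sub_zero]
        exact_mod_cast this
    simp only [this, Finset.sum_sub_distrib]
    simp
  -- Interpolation on {0, 1, -1} by a quadratic in χ(a) reduces everything to the sums of χ and χ².
  have h3 : ∀ a : F, G (quadraticChar F a) = G 0 + (quadraticChar F a : ℝ) * ((G 1 - G (-1)) / 2) +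
      (quadraticChar F a : ℝ) ^ 2 * ((G 1 + G (-1)) / 2 - G 0) := by
    intro a
    by_cases h : a = 0
    · simp [h]
    · rcases quadraticChar_dichotomy h with h | h <;> rw [h] <;> push_cast <;> ring
  rw [hbij]
  simp only [h3, Finset.sum_add_distrib, ← Finset.sum_mul, h1, h2]
  simp
  ring

theorem sum_erase_zero_quadraticChar_comp (hF : ringChar F ≠ 2) (G : ℤ → ℝ) :
    ∑ a ∈ Finset.univ.erase (0 : F), G (quadraticChar F a) =
      ((Fintype.card F : ℝ) - 1) / 2 * (G 1 + G (-1)) := by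
  have h := sum_quadraticChar_comp hF G (one_ne_zero (α := F))
  simp only [one_mul] at h
  rw [Finset.sum_erase_eq_sub (Finset.mem_univ _), h, quadraticChar_zero]
  ring

/-- The contribution of a point of `F` to `traceSum`, in terms of the three values there. -/
noncomputable def localTrace (v : Fin 3 → F) : ℤ :=
  quadraticChar F (v 0 * v 1) + quadraticChar F (v 0 * v 2) + quadraticChar F (v 1 * v 2)

/-- The three values of a variable with law `traceLaw q`. -/
def traceVal : Fin 3 → ℤ := ![-1, 1, 3]

/-- The masses of `traceLaw q` at the points `traceVal`. -/
noncomputable def traceMass (q : ℕ) : Fin 3 → ℝ :=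
  ![3 * ((q : ℝ) + 2) / (4 * ((q : ℝ) + 3)), 6 / (4 * ((q : ℝ) + 3)), (q : ℝ) / (4 * ((q : ℝ) + 3))]

theorem sum_fin_three_fun {γ : Type*} [Fintype γ] (H : (Fin 3 → γ) → ℝ) :
    ∑ ρ, H ρ = ∑ a, ∑ b, ∑ c, H ![a, b, c] := by
  rw [← Fintype.sum_prod_type', ← Fintype.sum_prod_type']
  refine Fintype.sum_equiv ⟨fun ρ => ((ρ 0, ρ 1), ρ 2), fun t => ![t.1.1, t.1.2, t.2], ?_, ?_⟩ _ _ ?_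
  · intro ρ; ext i; fin_cases i <;> rfl
  · intro t; rfl
  · intro ρ
    congr 1
    ext i; fin_cases i <;> rfl

/-- The (q-1)³ triples without zeros have weight 1, and the 3(q-1)² triples with one zero have
weight 1 - 1/q, which gives the total (q-1)³(q+3)/q. Scaling by `u` only permutes the values and
changes no weight. -/
theorem sum_localWeight_mul (hF : ringChar F ≠ 2) (ψ : ℤ → ℝ) {u : Fin 3 → F} (hu : ∀ i, u i ≠ 0) :
    ∑ ρ : Fin 3 → F, localWeight ρ * ψ (localTrace fun i => u i * ρ i) =
      ((Fintype.card F : ℝ) - 1) ^ 3 * ((Fintype.card F : ℝ) + 3) / Fintype.card F *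
        ∑ b, traceMass (Fintype.card F) b * ψ (traceVal b) := by
  have hq0 : (Fintype.card F : ℝ) ≠ 0 := by exact_mod_cast Fintype.card_ne_zero
  set q : ℝ := (Fintype.card F : ℝ) with hq
  have hq3 : q + 3 ≠ 0 := by rw [hq]; positivity
  -- Weight and trace depend only on the three character values, since χ(u a) = 0 exactly when a =
  -- 0; the sum can then be evaluated one variable at a time.
  let W : ℤ → ℤ → ℤ → ℝ := fun x y z => (∑ j : Option (Fin 3), ∏ i, if j = some i then
    (if ![x, y, z] i = 0 then 1 - 1 / q else 0) else (if ![x, y, z] i = 0 then 0 else 1)) *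
      ψ (x * y + x * z + y * z)
  have hW : ∀ a b c : F, localWeight ![a, b, c] * ψ (localTrace fun i => u i * ![a, b, c] i) =
      W (quadraticChar F (u 0 * a)) (quadraticChar F (u 1 * b)) (quadraticChar F (u 2 * c)) := by
    intro a b c
    have hz : ∀ i a, quadraticChar F (u i * a) = 0 ↔ a = 0 := by
      intro i a
      rw [quadraticChar_eq_zero_iff, mul_eq_zero, or_iff_right (hu i)]
    have hψ : localTrace (fun i => u i * ![a, b, c] i) =
        quadraticChar F (u 0 * a) * quadraticChar F (u 1 * b) +
        quadraticChar F (u 0 * a) * quadraticChar F (u 2 * c) +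
        quadraticChar F (u 1 * b) * quadraticChar F (u 2 * c) := by
      rw [← map_mul, ← map_mul, ← map_mul]
      rfl
    rw [hψ]
    simp only [W]
    congr 1
    simp only [localWeight, Fintype.sum_option, Fin.sum_univ_three, Fin.prod_univ_three,
      Matrix.cons_val_zero, Matrix.cons_val_one, Matrix.cons_val, hz]
    by_cases ha : a = 0 <;> by_cases hb : b = 0 <;> by_cases hc : c = 0 <;> simp [ha, hb, hc, hq]
  have s2 : ∀ x y, ∑ c, W x y (quadraticChar F (u 2 * c)) =
      W x y 0 + (q - 1) / 2 * (W x y 1 + W x y (-1)) :=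
    fun x y => sum_quadraticChar_comp hF (W x y) (hu 2)
  have s1 : ∀ (V : ℤ → ℤ → ℝ) (x : ℤ), ∑ b, V x (quadraticChar F (u 1 * b)) =
      V x 0 + (q - 1) / 2 * (V x 1 + V x (-1)) :=
    fun V x => sum_quadraticChar_comp hF (V x) (hu 1)
  have s0 : ∀ V : ℤ → ℝ, ∑ a, V (quadraticChar F (u 0 * a)) =
      V 0 + (q - 1) / 2 * (V 1 + V (-1)) :=
    fun V => sum_quadraticChar_comp hF V (hu 0)
  rw [sum_fin_three_fun]
  simp only [hW, s2]
  simp only [s1 (fun x y => W x y 0 + (q - 1) / 2 * (W x y 1 + W x y (-1)))]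
  rw [s0 (fun x => W x 0 0 + (q - 1) / 2 * (W x 0 1 + W x 0 (-1)) +
    (q - 1) / 2 * (W x 1 0 + (q - 1) / 2 * (W x 1 1 + W x 1 (-1)) +
      (W x (-1) 0 + (q - 1) / 2 * (W x (-1) 1 + W x (-1) (-1)))))]
  simp [W, Fintype.sum_option, Fin.sum_univ_three, Fin.prod_univ_three, traceMass, traceVal, ← hq]
  field_simp
  ring
end Characters
end

/-! ### Independence over several points. -/

theorem sum_fin_succ_fun {γ : Type*} [Fintype γ] {n : ℕ} (G : (Fin (n + 1) → γ) → ℝ) :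
    ∑ r, G r = ∑ a : γ, ∑ r : Fin n → γ, G (Fin.cons a r) := by
  rw [← Fintype.sum_prod_type']
  exact (Fintype.sum_equiv (Fin.consEquiv fun _ => γ) _ _ fun _ => rfl).symm

/-- The hypothesis says that the image under `l` of the weight `w` is c times the image under `v` of
`p`; the conclusion is its n-fold convolution. Splitting off a coordinate translates φ, hence the
induction over all φ. -/
theorem sum_prod_mul_comp_fin {α β : Type*} [Fintype α] [Fintype β] {w : α → ℝ} {l : α → ℤ}
    {p : β → ℝ} {v : β → ℤ} {c : ℝ}
    (h : ∀ ψ : ℤ → ℝ, ∑ a, w a * ψ (l a) = c * ∑ b, p b * ψ (v b)) (n : ℕ) (φ : ℤ → ℝ) :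
    ∑ r : Fin n → α, (∏ i, w (r i)) * φ (∑ i, l (r i)) =
      c ^ n * ∑ s : Fin n → β, (∏ i, p (s i)) * φ (∑ i, v (s i)) := by
  induction n generalizing φ with
  | zero => simp
  | succ n ih =>
    rw [sum_fin_succ_fun, sum_fin_succ_fun]
    simp only [Fin.prod_univ_succ, Fin.sum_univ_succ, Fin.cons_zero, Fin.cons_succ, mul_assoc,
      ← Finset.mul_sum]
    have h1 : ∀ a, ∑ r : Fin n → α, (∏ i, w (r i)) * φ (l a + ∑ i, l (r i)) =
        c ^ n * ∑ s : Fin n → β, (∏ i, p (s i)) * φ (l a + ∑ i, v (s i)) :=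
      fun a => ih fun z => φ (l a + z)
    simp only [h1]
    rw [h fun z => c ^ n * ∑ s : Fin n → β, (∏ i, p (s i)) * φ (z + ∑ i, v (s i))]
    simp only [mul_left_comm _ (c ^ n), ← Finset.mul_sum]
    ring

theorem sum_prod_mul_comp {ι α β : Type*} [Fintype ι] [DecidableEq ι] [Fintype α] [Fintype β]
    {w : α → ℝ} {l : α → ℤ} {p : β → ℝ} {v : β → ℤ} {c : ℝ}
    (h : ∀ ψ : ℤ → ℝ, ∑ a, w a * ψ (l a) = c * ∑ b, p b * ψ (v b)) (φ : ℤ → ℝ) :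
    ∑ r : ι → α, (∏ i, w (r i)) * φ (∑ i, l (r i)) =
      c ^ Fintype.card ι *
        ∑ s : Fin (Fintype.card ι) → β, (∏ i, p (s i)) * φ (∑ i, v (s i)) := by
  rw [← sum_prod_mul_comp_fin h]
  have e := Fintype.equivFin ι
  refine Fintype.sum_equiv (e.arrowCongr (Equiv.refl α)) _ _ fun r => ?_
  congr 1
  · exact Fintype.prod_equiv e _ _ fun i => by simp
  · congr 1
    exact Fintype.sum_equiv e _ _ fun i => by simp

/-- The expectation of `φ (X₁ + ⋯ + Xₙ)` for independent `Xⱼ` with law `traceLaw q`. -/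
noncomputable def traceExp (q n : ℕ) (φ : ℤ → ℝ) : ℝ :=
  ∑ s : Fin n → Fin 3, (∏ i, traceMass q (s i)) * φ (∑ i, traceVal (s i))

theorem traceExp_succ (q n : ℕ) (φ : ℤ → ℝ) :
    traceExp q (n + 1) φ =
      ∑ b, traceMass q b * traceExp q n fun z => φ (traceVal b + z) := by
  rw [traceExp, sum_fin_succ_fun]
  refine Finset.sum_congr rfl fun b _ => ?_
  rw [traceExp, Finset.mul_sum]
  refine Finset.sum_congr rfl fun s _ => ?_
  simp only [Fin.prod_univ_succ, Fin.sum_univ_succ, Fin.cons_zero, Fin.cons_succ,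
    mul_assoc]

/-! ### The point at infinity and the four components. -/

section
variable {F : Type*} [Field F] [Fintype F]

theorem sum_sqfreeTriples_eval [DecidableEq F] (d : Fin 3 → ℕ) (Φ : (F → Fin 3 → F) → ℝ) :
    ∑ p ∈ sqfreeTriples F d, Φ (fun x i => (p i).eval x) =
      ∑ r : F → Fin 3 → F, (countValues d r : ℝ) * Φ r := by
  rw [← Finset.sum_fiberwise (sqfreeTriples F d) (fun p x i => (p i).eval x)]
  refine Finset.sum_congr rfl fun r _ => ?_
  rw [Finset.sum_congr rfl fun p hp => by rw [(Finset.mem_filter.1 hp).2], Finset.sum_const,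
    nsmul_eq_mul, countValues]
  congr 3
  ext p
  simp [funext_iff]

/-- The degrees of the component of `biquadraticTriples` with index `c`. -/
def componentDegrees (d : Fin 3 → ℕ) (c : Option (Fin 3)) (i : Fin 3) : ℕ :=
  if c = some i then d i - 1 else d i

/-- The relative size of the component of `biquadraticTriples` with index `c`. -/
noncomputable def componentWeight (q : ℕ) (c : Option (Fin 3)) : ℝ :=
  if c = none then 1 else 1 / (q : ℝ)

theorem prod_rpow_componentDegrees {q : ℕ} (hq : 0 < q) {d : Fin 3 → ℕ} (hd : ∀ i, 1 ≤ d i)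
    (c : Option (Fin 3)) :
    ∏ i, (q : ℝ) ^ ((componentDegrees d c i : ℝ) - q) =
      componentWeight q c * ∏ i, (q : ℝ) ^ ((d i : ℝ) - q) := by
  have hq0 : (0 : ℝ) < q := by exact_mod_cast hq
  have h1 : ∀ i, (q : ℝ) ^ (((d i - 1 : ℕ) : ℝ) - q) = 1 / (q : ℝ) * (q : ℝ) ^ ((d i : ℝ) - q) := by
    intro i
    rw [Nat.cast_sub (hd i), Nat.cast_one, show (d i : ℝ) - 1 - q = ((d i : ℝ) - q) - 1 by ring,
      Real.rpow_sub_one hq0.ne']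
    ring
  rcases c with _ | c
  · simp [componentDegrees, componentWeight]
  · fin_cases c <;> simp [componentDegrees, componentWeight, Fin.prod_univ_three, h1] <;> ring

section
variable [DecidableEq F]

/-- The contribution of the point at infinity to `traceSum`, in terms of the degrees and leading
coefficients. -/
noncomputable def infTrace (d : Fin 3 → ℕ) (u : Fin 3 → F) : ℤ :=
  (if Odd (d 0 + d 1) then 0 else quadraticChar F (u 0 * u 1)) +
  (if Odd (d 0 + d 2) then 0 else quadraticChar F (u 0 * u 2)) +
  (if Odd (d 1 + d 2) then 0 else quadraticChar F (u 1 * u 2))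

/-- In the main component all three characters occur. Lowering one degree makes two of the degree
sums odd, leaving one fair sign with weight 1/q, which mirrors an affine point where one value is
zero. Only two leading coefficients vary, so (q-1)² replaces (q-1)³. -/
theorem sum_infTrace (hF : ringChar F ≠ 2) {d : Fin 3 → ℕ} (hd : ∀ i, 1 ≤ d i)
    (h01 : d 0 % 2 = d 1 % 2) (h12 : d 1 % 2 = d 2 % 2) (ψ : ℤ → ℝ) :
    ∑ c, ∑ u₁ ∈ Finset.univ.erase (0 : F), ∑ u₂ ∈ Finset.univ.erase (0 : F),
      componentWeight (Fintype.card F) c * ψ (infTrace (componentDegrees d c) ![1, u₁, u₂]) =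
      ((Fintype.card F : ℝ) - 1) ^ 2 * ((Fintype.card F : ℝ) + 3) / Fintype.card F *
        ∑ b, traceMass (Fintype.card F) b * ψ (traceVal b) := by
  have hq0 : (Fintype.card F : ℝ) ≠ 0 := by exact_mod_cast Fintype.card_ne_zero
  set q : ℝ := (Fintype.card F : ℝ) with hq
  have hq3 : q + 3 ≠ 0 := by rw [hq]; positivity
  have d0 := hd 0
  have d1 := hd 1
  have d2 := hd 2
  have o1 : ¬ Odd (d 0 + d 1) := by rw [Nat.odd_iff]; omega
  have o2 : ¬ Odd (d 0 + d 2) := by rw [Nat.odd_iff]; omega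
  have o3 : ¬ Odd (d 1 + d 2) := by rw [Nat.odd_iff]; omega
  have o4 : Odd (d 0 - 1 + d 1) := by rw [Nat.odd_iff]; omega
  have o5 : Odd (d 0 - 1 + d 2) := by rw [Nat.odd_iff]; omega
  have o6 : Odd (d 0 + (d 1 - 1)) := by rw [Nat.odd_iff]; omega
  have o7 : Odd (d 1 - 1 + d 2) := by rw [Nat.odd_iff]; omega
  have o8 : Odd (d 0 + (d 2 - 1)) := by rw [Nat.odd_iff]; omega
  have o9 : Odd (d 1 + (d 2 - 1)) := by rw [Nat.odd_iff]; omega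
  have key : ∀ V : ℤ → ℤ → ℝ, ∑ u₁ ∈ Finset.univ.erase (0 : F), ∑ u₂ ∈ Finset.univ.erase (0 : F),
      V (quadraticChar F u₁) (quadraticChar F u₂) =
      ((q - 1) / 2) ^ 2 * (V 1 1 + V 1 (-1) + V (-1) 1 + V (-1) (-1)) := by
    intro V
    simp only [fun x => sum_erase_zero_quadraticChar_comp hF (V x)]
    rw [sum_erase_zero_quadraticChar_comp hF
      (fun x => ((Fintype.card F : ℝ) - 1) / 2 * (V x 1 + V x (-1))), ← hq]
    ring
  have e0 : ∀ u₁ u₂ : F, infTrace (componentDegrees d none) ![1, u₁, u₂] =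
      quadraticChar F u₁ + quadraticChar F u₂ + quadraticChar F u₁ * quadraticChar F u₂ := by
    intro u₁ u₂
    simp [infTrace, componentDegrees, o1, o2, o3]
    exact quadraticCharFun_mul u₁ u₂
  have e1 : ∀ u₁ u₂ : F, infTrace (componentDegrees d (some 0)) ![1, u₁, u₂] =
      quadraticChar F u₁ * quadraticChar F u₂ := by
    intro u₁ u₂
    simp [infTrace, componentDegrees, o4, o5, o3]
    exact quadraticCharFun_mul u₁ u₂
  have e2 : ∀ u₁ u₂ : F, infTrace (componentDegrees d (some 1)) ![1, u₁, u₂] =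
      quadraticChar F u₂ := by
    intro u₁ u₂
    simp [infTrace, componentDegrees, o6, o7, o2]
  have e3 : ∀ u₁ u₂ : F, infTrace (componentDegrees d (some 2)) ![1, u₁, u₂] =
      quadraticChar F u₁ := by
    intro u₁ u₂
    simp [infTrace, componentDegrees, o8, o9, o1]
  rw [Fintype.sum_option, Fin.sum_univ_three]
  simp only [e0, e1, e2, e3]
  rw [key fun x y => componentWeight (Fintype.card F) none * ψ (x + y + x * y),
    key fun x y => componentWeight (Fintype.card F) (some 0) * ψ (x * y),
    key fun x y => componentWeight (Fintype.card F) (some 1) * ψ y,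
    key fun x y => componentWeight (Fintype.card F) (some 2) * ψ x]
  simp [componentWeight, Fin.sum_univ_three, traceMass, traceVal, ← hq]
  field_simp
  ring

/-- For fixed leading coefficients the affine points give q independent copies of the law, whatever
the coefficients are; averaging over infinity adds one more. -/
theorem sum_config (hF : ringChar F ≠ 2) {d : Fin 3 → ℕ} (hd : ∀ i, 1 ≤ d i)
    (h01 : d 0 % 2 = d 1 % 2) (h12 : d 1 % 2 = d 2 % 2) (φ : ℤ → ℝ) :
    ∑ c, ∑ u₁ ∈ Finset.univ.erase (0 : F), ∑ u₂ ∈ Finset.univ.erase (0 : F),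
      componentWeight (Fintype.card F) c * ∑ r : F → Fin 3 → F, (∏ x, localWeight (r x)) *
        φ (infTrace (componentDegrees d c) ![1, u₁, u₂] +
          ∑ x, localTrace fun i => (![1, u₁, u₂] : Fin 3 → F) i * r x i) =
      (((Fintype.card F : ℝ) - 1) ^ 2 * ((Fintype.card F : ℝ) + 3) / Fintype.card F) *
      (((Fintype.card F : ℝ) - 1) ^ 3 * ((Fintype.card F : ℝ) + 3) / Fintype.card F) ^
        Fintype.card F * traceExp (Fintype.card F) (Fintype.card F + 1) φ := by
  set W := ((Fintype.card F : ℝ) - 1) ^ 3 * ((Fintype.card F : ℝ) + 3) / Fintype.card F with hW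
  have h1 : ∀ (z : ℤ), ∀ u₁ ∈ Finset.univ.erase (0 : F), ∀ u₂ ∈ Finset.univ.erase (0 : F),
      ∑ r : F → Fin 3 → F, (∏ x, localWeight (r x)) *
        φ (z + ∑ x, localTrace fun i => (![1, u₁, u₂] : Fin 3 → F) i * r x i) =
      W ^ Fintype.card F * traceExp (Fintype.card F) (Fintype.card F) fun y => φ (z + y) := by
    intro z u₁ hu₁ u₂ hu₂
    have hu : ∀ i, (![1, u₁, u₂] : Fin 3 → F) i ≠ 0 := by
      intro i
      fin_cases i
      · exact one_ne_zero
      · exact Finset.ne_of_mem_erase hu₁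
      · exact Finset.ne_of_mem_erase hu₂
    exact sum_prod_mul_comp (fun ψ => sum_localWeight_mul hF ψ hu) fun y => φ (z + y)
  have h2 : ∀ c, ∑ u₁ ∈ Finset.univ.erase (0 : F), ∑ u₂ ∈ Finset.univ.erase (0 : F),
      componentWeight (Fintype.card F) c * ∑ r : F → Fin 3 → F, (∏ x, localWeight (r x)) *
        φ (infTrace (componentDegrees d c) ![1, u₁, u₂] +
          ∑ x, localTrace fun i => (![1, u₁, u₂] : Fin 3 → F) i * r x i) =
      ∑ u₁ ∈ Finset.univ.erase (0 : F), ∑ u₂ ∈ Finset.univ.erase (0 : F),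
        componentWeight (Fintype.card F) c * (fun z => W ^ Fintype.card F *
          traceExp (Fintype.card F) (Fintype.card F) fun y => φ (z + y))
          (infTrace (componentDegrees d c) ![1, u₁, u₂]) := fun c =>
    Finset.sum_congr rfl fun u₁ hu₁ => Finset.sum_congr rfl fun u₂ hu₂ => by
      rw [h1 _ u₁ hu₁ u₂ hu₂]
  refine (Finset.sum_congr rfl fun c _ => h2 c).trans
    ((sum_infTrace hF hd h01 h12 (fun z => W ^ Fintype.card F *
      traceExp (Fintype.card F) (Fintype.card F) fun y => φ (z + y))).trans ?_)
  rw [traceExp_succ]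
  simp only [mul_left_comm _ (W ^ Fintype.card F), ← Finset.mul_sum]
  ring

/-- The triple with monic parts `p` and leading coefficients `1, u₁, u₂`. -/
noncomputable def scaledTriple (u₁ u₂ : F) (p : Fin 3 → F[X]) : F[X] × F[X] × F[X] :=
  (p 0, C u₁ * p 1, C u₂ * p 2)

theorem chiAt_none {f : F[X]} {n : ℕ} {a : F} (hn : f.natDegree = n) (ha : f.leadingCoeff = a) :
    chiAt f none = if Odd n then 0 else quadraticChar F a := by
  subst hn ha
  rfl

theorem traceSum_scaledTriple {u₁ u₂ : F} (hu₁ : u₁ ≠ 0) (hu₂ : u₂ ≠ 0) {d : Fin 3 → ℕ}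
    {p : Fin 3 → F[X]} (hp : ∀ i, p i ∈ monicPolys F (d i)) :
    traceSum (scaledTriple u₁ u₂ p) = infTrace d ![1, u₁, u₂] +
      ∑ x, localTrace fun i => (![1, u₁, u₂] : Fin 3 → F) i * (p i).eval x := by
  have hm : ∀ i, (p i).Monic := fun i => (mem_monicPolys.1 (hp i)).1
  have hd : ∀ i, (p i).natDegree = d i := fun i => (mem_monicPolys.1 (hp i)).2
  have hn : ∀ i, p i ≠ 0 := fun i => (hm i).ne_zero
  have hc₁ : C u₁ ≠ 0 := C_ne_zero.2 hu₁
  have hc₂ : C u₂ ≠ 0 := C_ne_zero.2 hu₂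
  rw [traceSum, Fintype.sum_option]
  congr 1
  · have h1 : (C u₁ * p 1).natDegree = d 1 := by rw [natDegree_C_mul hu₁, hd]
    have h2 : (C u₂ * p 2).natDegree = d 2 := by rw [natDegree_C_mul hu₂, hd]
    have l1 : (C u₁ * p 1).leadingCoeff = u₁ := by simp [(hm 1).leadingCoeff]
    have l2 : (C u₂ * p 2).leadingCoeff = u₂ := by simp [(hm 2).leadingCoeff]
    rw [chiAt_none (n := d 0 + d 1) (a := 1 * u₁), chiAt_none (n := d 0 + d 2) (a := 1 * u₂),
      chiAt_none (n := d 1 + d 2) (a := u₁ * u₂)]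
    · rfl
    · rw [scaledTriple, natDegree_mul (mul_ne_zero hc₁ (hn 1)) (mul_ne_zero hc₂ (hn 2)), h1, h2]
    · rw [scaledTriple, leadingCoeff_mul, l1, l2]
    · rw [scaledTriple, natDegree_mul (hn 0) (mul_ne_zero hc₂ (hn 2)), h2, hd]
    · rw [scaledTriple, leadingCoeff_mul, l2, (hm 0).leadingCoeff]
    · rw [scaledTriple, natDegree_mul (hn 0) (mul_ne_zero hc₁ (hn 1)), h1, hd]
    · rw [scaledTriple, leadingCoeff_mul, l1, (hm 0).leadingCoeff]
  · refine Finset.sum_congr rfl fun x _ => ?_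
    simp [scaledTriple, chiAt, localTrace]
end
end

/-! ### From monic triples to the family, with relative error. -/

section
variable {F : Type*} [Field F] [Fintype F]

theorem squarefree_prod_three_iff {K : Type*} [Field K] (p : Fin 3 → K[X]) : Squarefree (∏ i, p i) ↔
    Squarefree (p 0) ∧ Squarefree (p 1) ∧ Squarefree (p 2) ∧
      IsCoprime (p 0) (p 1) ∧ IsCoprime (p 0) (p 2) ∧ IsCoprime (p 1) (p 2) := by
  rw [Fin.prod_univ_three, squarefree_mul_iff, squarefree_mul_iff, isRelPrime_iff_isCoprime,
    isRelPrime_iff_isCoprime, IsCoprime.mul_left_iff]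
  tauto

theorem mem_sqfreeTriples {d : Fin 3 → ℕ} {p : Fin 3 → F[X]} :
    p ∈ sqfreeTriples F d ↔ (∀ i, p i ∈ monicPolys F (d i)) ∧ Squarefree (∏ i, p i) := by
  simp [sqfreeTriples]

theorem squarefree_C_mul_iff {K : Type*} [Field K] {u : K} (hu : u ≠ 0) (p : K[X]) :
    Squarefree (C u * p) ↔ Squarefree p :=
  (associated_unit_mul_left p (C u) (isUnit_C.2 hu.isUnit)).squarefree_iff

theorem mem_coprimeTriples_scaledTriple {u₁ u₂ : F} (hu₁ : u₁ ≠ 0) (hu₂ : u₂ ≠ 0) {d : Fin 3 → ℕ}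
    {p : Fin 3 → F[X]} (hp : p ∈ sqfreeTriples F d) :
    scaledTriple u₁ u₂ p ∈ coprimeTriples F (d 0) (d 1) (d 2) := by
  rw [mem_sqfreeTriples, squarefree_prod_three_iff] at hp
  simp only [mem_monicPolys] at hp
  obtain ⟨hp, s0, s1, s2, c01, c02, c12⟩ := hp
  have v1 : IsUnit (C u₁) := isUnit_C.2 hu₁.isUnit
  have v2 : IsUnit (C u₂) := isUnit_C.2 hu₂.isUnit
  refine ⟨(hp 0).1, s0, (squarefree_C_mul_iff hu₁ _).2 s1, (squarefree_C_mul_iff hu₂ _).2 s2,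
    (hp 0).2, ?_, ?_, ?_, ?_, ?_⟩
  · exact (natDegree_C_mul hu₁).trans (hp 1).2
  · exact (natDegree_C_mul hu₂).trans (hp 2).2
  · exact (isCoprime_mul_unit_left_right v1 _ _).2 c01
  · exact (isCoprime_mul_unit_left_right v2 _ _).2 c02
  · exact (isCoprime_mul_unit_left_left v1 _ _).2 ((isCoprime_mul_unit_left_right v2 _ _).2 c12)

theorem exists_scaledTriple_eq {d : Fin 3 → ℕ} {t : F[X] × F[X] × F[X]}
    (ht : t ∈ coprimeTriples F (d 0) (d 1) (d 2)) :
    ∃ u₁ u₂ p, u₁ ≠ 0 ∧ u₂ ≠ 0 ∧ p ∈ sqfreeTriples F d ∧ scaledTriple u₁ u₂ p = t := by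
  obtain ⟨f, f₁, f₂⟩ := t
  obtain ⟨hm, s0, s1, s2, d0, d1, d2, c01, c02, c12⟩ := ht
  dsimp only at hm s0 s1 s2 d0 d1 d2 c01 c02 c12
  have l1 : f₁.leadingCoeff ≠ 0 := leadingCoeff_ne_zero.2 s1.ne_zero
  have l2 : f₂.leadingCoeff ≠ 0 := leadingCoeff_ne_zero.2 s2.ne_zero
  have v1 : IsUnit (C f₁.leadingCoeff⁻¹) := isUnit_C.2 (inv_ne_zero l1).isUnit
  have v2 : IsUnit (C f₂.leadingCoeff⁻¹) := isUnit_C.2 (inv_ne_zero l2).isUnit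
  refine ⟨f₁.leadingCoeff, f₂.leadingCoeff,
    ![f, C f₁.leadingCoeff⁻¹ * f₁, C f₂.leadingCoeff⁻¹ * f₂], l1, l2, ?_, ?_⟩
  · rw [mem_sqfreeTriples, squarefree_prod_three_iff]
    simp only [mem_monicPolys]
    refine ⟨?_, s0, (squarefree_C_mul_iff (inv_ne_zero l1) _).2 s1,
      (squarefree_C_mul_iff (inv_ne_zero l2) _).2 s2, ?_, ?_, ?_⟩
    · intro i
      fin_cases i
      · exact ⟨hm, d0⟩
      · exact ⟨by
          rw [Monic]
          simp [l1], (natDegree_C_mul (inv_ne_zero l1)).trans d1⟩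
      · exact ⟨by
          rw [Monic]
          simp [l2], (natDegree_C_mul (inv_ne_zero l2)).trans d2⟩
    · exact (isCoprime_mul_unit_left_right v1 _ _).2 c01
    · exact (isCoprime_mul_unit_left_right v2 _ _).2 c02
    · exact (isCoprime_mul_unit_left_left v1 _ _).2 ((isCoprime_mul_unit_left_right v2 _ _).2 c12)
  · simp only [scaledTriple, Matrix.cons_val_zero, Matrix.cons_val_one, Matrix.cons_val,
      ← mul_assoc, ← C_mul, mul_inv_cancel₀ l1, mul_inv_cancel₀ l2, C_1, one_mul]

theorem scaledTriple_injective {d : Fin 3 → ℕ} {u₁ u₂ v₁ v₂ : F} {p p' : Fin 3 → F[X]}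
    (hu₁ : u₁ ≠ 0) (hu₂ : u₂ ≠ 0)
    (hp : p ∈ sqfreeTriples F d) (hp' : p' ∈ sqfreeTriples F d)
    (h : scaledTriple u₁ u₂ p = scaledTriple v₁ v₂ p') : u₁ = v₁ ∧ u₂ = v₂ ∧ p = p' := by
  rw [mem_sqfreeTriples] at hp hp'
  have hm : ∀ i, (p i).Monic := fun i => (mem_monicPolys.1 (hp.1 i)).1
  have hm' : ∀ i, (p' i).Monic := fun i => (mem_monicPolys.1 (hp'.1 i)).1
  simp only [scaledTriple, Prod.mk.injEq] at h
  obtain ⟨h0, h1, h2⟩ := h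
  have e1 : u₁ = v₁ := by
    simpa [(hm 1).leadingCoeff, (hm' 1).leadingCoeff] using congrArg leadingCoeff h1
  have e2 : u₂ = v₂ := by
    simpa [(hm 2).leadingCoeff, (hm' 2).leadingCoeff] using congrArg leadingCoeff h2
  subst e1 e2
  refine ⟨rfl, rfl, ?_⟩
  funext i
  fin_cases i
  · exact h0
  · exact mul_left_cancel₀ (C_ne_zero.2 hu₁) h1
  · exact mul_left_cancel₀ (C_ne_zero.2 hu₂) h2

variable [DecidableEq F]

/-- `coprimeTriples` as a finite set. -/
noncomputable def coprimeTriplesFinset (F : Type*) [Field F] [Fintype F] [DecidableEq F] (d : Fin 3 → ℕ) :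
    Finset (F[X] × F[X] × F[X]) :=
  (Finset.univ.erase (0 : F) ×ˢ Finset.univ.erase (0 : F) ×ˢ sqfreeTriples F d).image
    fun x => scaledTriple x.1 x.2.1 x.2.2

theorem mem_coprimeTriplesFinset {d : Fin 3 → ℕ} {t : F[X] × F[X] × F[X]} :
    t ∈ coprimeTriplesFinset F d ↔ t ∈ coprimeTriples F (d 0) (d 1) (d 2) := by
  simp only [coprimeTriplesFinset, Finset.mem_image, Finset.mem_product, Prod.exists]
  constructor
  · rintro ⟨u₁, u₂, p, ⟨h1, h2, h3⟩, rfl⟩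
    exact mem_coprimeTriples_scaledTriple (Finset.ne_of_mem_erase h1) (Finset.ne_of_mem_erase h2) h3
  · intro ht
    obtain ⟨u₁, u₂, p, h1, h2, h3, h4⟩ := exists_scaledTriple_eq ht
    exact ⟨u₁, u₂, p, ⟨by simpa using h1, by simpa using h2, h3⟩, h4⟩

theorem sum_coprimeTriplesFinset (d : Fin 3 → ℕ) (φ : ℤ → ℝ) :
    ∑ t ∈ coprimeTriplesFinset F d, φ (traceSum t) =
      ∑ u₁ ∈ Finset.univ.erase (0 : F), ∑ u₂ ∈ Finset.univ.erase (0 : F),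
        ∑ r : F → Fin 3 → F, (countValues d r : ℝ) * φ (infTrace d ![1, u₁, u₂] +
          ∑ x, localTrace fun i => (![1, u₁, u₂] : Fin 3 → F) i * r x i) := by
  rw [coprimeTriplesFinset, Finset.sum_image]
  · rw [Finset.sum_product]
    refine Finset.sum_congr rfl fun u₁ hu₁ => ?_
    rw [Finset.sum_product]
    refine Finset.sum_congr rfl fun u₂ hu₂ => ?_
    refine Eq.trans ?_ (sum_sqfreeTriples_eval d fun r => φ (infTrace d ![1, u₁, u₂] +
          ∑ x, localTrace fun i => (![1, u₁, u₂] : Fin 3 → F) i * r x i))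
    refine Finset.sum_congr rfl fun p hp => ?_
    rw [mem_sqfreeTriples] at hp
    rw [traceSum_scaledTriple (Finset.ne_of_mem_erase hu₁) (Finset.ne_of_mem_erase hu₂) hp.1]
  · rintro ⟨u₁, u₂, p⟩ h ⟨v₁, v₂, p'⟩ h' he
    simp only [Finset.coe_product, Set.mem_prod, Finset.mem_coe] at h h'
    obtain ⟨rfl, rfl, rfl⟩ := scaledTriple_injective (Finset.ne_of_mem_erase h.1)
      (Finset.ne_of_mem_erase h.2.1) h.2.2 h'.2.2 he
    rfl

/-- `biquadraticTriples` as a finite set, when all degrees are positive. -/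
noncomputable def biquadraticFinset (F : Type*) [Field F] [Fintype F] [DecidableEq F] (d : Fin 3 → ℕ) :
    Finset (F[X] × F[X] × F[X]) :=
  Finset.univ.biUnion fun c : Option (Fin 3) => coprimeTriplesFinset F (componentDegrees d c)

theorem coe_biquadraticFinset {d : Fin 3 → ℕ} (hd : ∀ i, 1 ≤ d i) :
    (biquadraticFinset F d : Set (F[X] × F[X] × F[X])) =
      biquadraticTriples F (d 0) (d 1) (d 2) := by
  ext t
  have d0 := hd 0
  have d1 := hd 1
  have d2 := hd 2
  have e : ∀ {n k : ℕ}, 1 ≤ n → (k + 1 = n ↔ k = n - 1) := by omega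
  simp only [biquadraticFinset, Finset.mem_coe, Finset.mem_biUnion, Finset.mem_univ, true_and,
    mem_coprimeTriplesFinset, Option.exists, Fin.exists_fin_succ, biquadraticTriples,
    Set.mem_ofPred_eq, e d0, e d1, e d2, exists_eq_left]
  simp [componentDegrees]

theorem sum_biquadraticFinset {d : Fin 3 → ℕ} (hd : ∀ i, 1 ≤ d i) (φ : ℤ → ℝ) :
    ∑ t ∈ biquadraticFinset F d, φ (traceSum t) =
      ∑ c, ∑ u₁ ∈ Finset.univ.erase (0 : F), ∑ u₂ ∈ Finset.univ.erase (0 : F),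
        ∑ r : F → Fin 3 → F, (countValues (componentDegrees d c) r : ℝ) *
          φ (infTrace (componentDegrees d c) ![1, u₁, u₂] +
            ∑ x, localTrace fun i => (![1, u₁, u₂] : Fin 3 → F) i * r x i) := by
  rw [biquadraticFinset, Finset.sum_biUnion]
  · exact Finset.sum_congr rfl fun c _ => sum_coprimeTriplesFinset _ φ
  · intro c _ c' _ hcc
    rw [Function.onFun, Finset.disjoint_left]
    intro t ht ht'
    rw [mem_coprimeTriplesFinset] at ht ht'
    obtain ⟨-, -, -, -, a0, a1, a2, -⟩ := ht
    obtain ⟨-, -, -, -, b0, b1, b2, -⟩ := ht'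
    apply hcc
    have h : ∀ i, componentDegrees d c i = componentDegrees d c' i := by
      intro i
      fin_cases i
      · exact a0.symm.trans b0
      · exact a1.symm.trans b1
      · exact a2.symm.trans b2
    -- A component is determined by its degrees: `d i - 1` differs from `d i` because `d i ≥ 1`.
    have key : ∀ c c' : Option (Fin 3), (∀ i, componentDegrees d c i = componentDegrees d c' i) →
        ∀ i, c = some i → c' = some i := by
      intro c c' h i hi
      have := h i
      have := hd i
      by_contra hn
      simp [componentDegrees, hi, hn] at *
      omega
    rcases c with _ | i
    · rcases c' with _ | j
      · rfl
      · exact (key _ _ (fun i => (h i).symm) j rfl)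
    · exact (key _ _ h i rfl).symm

/-- A relative error for each value assignment survives summation against a nonnegative φ. The
constant `A` is the same for all φ, so it cancels between φ = 1 and the indicator of M. The
condition `m + 1 ≤ d i` leaves room for the lowered degree. -/
theorem abs_sum_biquadraticFinset_sub_le (hF : ringChar F ≠ 2) {d : Fin 3 → ℕ} (hd : ∀ i, 1 ≤ d i)
    (h01 : d 0 % 2 = d 1 % 2) (h12 : d 1 % 2 = d 2 % 2) {θ m : ℝ} (hθ0 : 0 < θ) (hθ1 : θ < 1 / 2)
    (hm : ∀ i, m + 1 ≤ d i) (hq : (Fintype.card F : ℝ) ≤ θ * m) :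
    ∃ A : ℝ, 0 < A ∧ ∀ φ : ℤ → ℝ, (∀ z, 0 ≤ φ z) →
      |∑ t ∈ biquadraticFinset F d, φ (traceSum t) -
          A * traceExp (Fintype.card F) (Fintype.card F + 1) φ| ≤
        (sieveErrorConst θ * 108 ^ Fintype.card F *
          (Fintype.card F : ℝ) ^ ((Fintype.card F : ℝ) - θ * m)) *
        (A * traceExp (Fintype.card F) (Fintype.card F + 1) φ) := by
  set N := ∏ i, (Fintype.card F : ℝ) ^ ((d i : ℝ) - Fintype.card F) with hN
  have hq1 := one_lt_card_real (F := F)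
  have hq0 : (0 : ℝ) < Fintype.card F := by linarith
  have hq1' : 0 < (Fintype.card F : ℝ) - 1 := by linarith
  set B := ∑ i, d i with hB
  have hK : 0 < sieveConst F B := (Real.exp_pos _).trans_le (exp_neg_le_sieveConst B)
  have hN0 : 0 < N := Finset.prod_pos fun i _ => by positivity
  set W := (((Fintype.card F : ℝ) - 1) ^ 2 * ((Fintype.card F : ℝ) + 3) / Fintype.card F) *
      (((Fintype.card F : ℝ) - 1) ^ 3 * ((Fintype.card F : ℝ) + 3) / Fintype.card F) ^
        Fintype.card F with hW
  refine ⟨N * sieveConst F B * W, by positivity, fun φ hφ => ?_⟩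
  set Y := sieveErrorConst θ * 108 ^ Fintype.card F *
          (Fintype.card F : ℝ) ^ ((Fintype.card F : ℝ) - θ * m) with hY
  have hA : N * sieveConst F B * W * traceExp (Fintype.card F) (Fintype.card F + 1) φ =
      ∑ c, ∑ u₁ ∈ Finset.univ.erase (0 : F), ∑ u₂ ∈ Finset.univ.erase (0 : F),
        ∑ r : F → Fin 3 → F, ((componentWeight (Fintype.card F) c * N) *
          (sieveConst F B * ∏ x, localWeight (r x))) *
          φ (infTrace (componentDegrees d c) ![1, u₁, u₂] +
            ∑ x, localTrace fun i => (![1, u₁, u₂] : Fin 3 → F) i * r x i) := by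
    rw [mul_assoc (N * _), hW, ← sum_config hF hd h01 h12 φ]
    simp only [Finset.mul_sum]
    refine Finset.sum_congr rfl fun c _ => Finset.sum_congr rfl fun u₁ _ =>
      Finset.sum_congr rfl fun u₂ _ => Finset.sum_congr rfl fun r _ => ?_
    ring
  rw [hA, sum_biquadraticFinset hd, ← Finset.sum_sub_distrib, Finset.mul_sum]
  refine (Finset.abs_sum_le_sum_abs _ _).trans (Finset.sum_le_sum fun c _ => ?_)
  rw [← Finset.sum_sub_distrib, Finset.mul_sum]
  refine (Finset.abs_sum_le_sum_abs _ _).trans (Finset.sum_le_sum fun u₁ _ => ?_)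
  rw [← Finset.sum_sub_distrib, Finset.mul_sum]
  refine (Finset.abs_sum_le_sum_abs _ _).trans (Finset.sum_le_sum fun u₂ _ => ?_)
  rw [← Finset.sum_sub_distrib, Finset.mul_sum]
  refine (Finset.abs_sum_le_sum_abs _ _).trans (Finset.sum_le_sum fun r _ => ?_)
  rw [← sub_mul, abs_mul, abs_of_nonneg (hφ _)]
  refine (mul_le_mul_of_nonneg_right ?_ (hφ _)).trans_eq (mul_assoc _ _ _)
  rw [← prod_rpow_componentDegrees (Fintype.card_pos (α := F)) hd c]
  refine abs_countValues_sub_le_mul (componentDegrees d c) r ?_ ?_ hθ0 hθ1 ?_ hq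
  · refine Finset.sum_le_sum fun i _ => ?_
    unfold componentDegrees
    split_ifs <;> omega
  · exact (hd 0).trans (Finset.single_le_sum (f := d) (fun _ _ => Nat.zero_le _) (Finset.mem_univ 0))
  · intro i
    have := hm i
    unfold componentDegrees
    split_ifs
    · rw [Nat.cast_sub (hd i)]; push_cast; linarith
    · linarith
end

/-! ### The limit law and a lower bound for its masses. -/

theorem traceMass_nonneg (q : ℕ) (b : Fin 3) : 0 ≤ traceMass q b := by
  fin_cases b <;> simp [traceMass] <;> positivity

theorem sum_traceMass (q : ℕ) : ∑ b, traceMass q b = 1 := by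
  simp only [Fin.sum_univ_three, traceMass, Matrix.cons_val_zero, Matrix.cons_val_one,
    Matrix.cons_val]
  field_simp
  ring

theorem traceExp_one (q n : ℕ) : traceExp q n (fun _ => 1) = 1 := by
  induction n with
  | zero => simp [traceExp]
  | succ n ih =>
    rw [traceExp_succ]
    simp only [ih, mul_one]
    exact sum_traceMass q

theorem traceVal_injective : Function.Injective traceVal := by decide

theorem traceLaw_real_singleton (q : ℕ) (b : Fin 3) :
    (traceLaw q).real {traceVal b} = traceMass q b := by
  have h0 : (0 : ℝ) ≤ 3 * ((q : ℝ) + 2) / (4 * ((q : ℝ) + 3)) := by positivity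
  have h1 : (0 : ℝ) ≤ 6 / (4 * ((q : ℝ) + 3)) := by positivity
  have h2 : (0 : ℝ) ≤ (q : ℝ) / (4 * ((q : ℝ) + 3)) := by positivity
  fin_cases b
  · simp [Measure.real, traceLaw, traceVal, traceMass, ENNReal.toReal_ofReal h0]
  · simp [Measure.real, traceLaw, traceVal, traceMass, ENNReal.toReal_ofReal h1]
  · simp [Measure.real, traceLaw, traceVal, traceMass, ENNReal.toReal_ofReal h2]

theorem ae_mem_range_traceVal (q : ℕ) : ∀ᵐ x ∂traceLaw q, x ∈ Set.range traceVal := by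
  rw [ae_iff]
  have h : ∀ b : Fin 3, traceVal b ∉ {a | a ∉ Set.range traceVal} := fun b h => h ⟨b, rfl⟩
  have h0 := h 0
  have h1 := h 1
  have h2 := h 2
  rw [show traceVal 0 = -1 from rfl] at h0
  rw [show traceVal 1 = 1 from rfl] at h1
  rw [show traceVal 2 = 3 from rfl] at h2
  simp only [traceLaw, Measure.coe_add, Measure.coe_smul, Pi.add_apply, Pi.smul_apply, smul_eq_mul]
  rw [Measure.dirac_apply' _ MeasurableSet.of_discrete,
    Measure.dirac_apply' _ MeasurableSet.of_discrete,
    Measure.dirac_apply' _ MeasurableSet.of_discrete,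
    Set.indicator_of_notMem h0, Set.indicator_of_notMem h1, Set.indicator_of_notMem h2]
  simp

/-- Almost every point of the product space has all its coordinates in {-1, 1, 3}, so the event
reduces to finitely many atoms. -/
theorem traceProb_eq_traceExp (q : ℕ) (M : ℤ) :
    traceProb q M = traceExp q (q + 1) fun z => if z = M then 1 else 0 := by
  classical
  set μ := Measure.pi fun _ : Fin (q + 1) => traceLaw q with hμ
  let f : (Fin (q + 1) → Fin 3) → (Fin (q + 1) → ℤ) := fun s j => traceVal (s j)
  have hf : Function.Injective f := fun s s' h =>
    funext fun j => traceVal_injective (congrFun h j)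
  let S : Finset (Fin (q + 1) → Fin 3) := Finset.univ.filter fun s => ∑ j, traceVal (s j) = M
  have hae : {x : Fin (q + 1) → ℤ | ∑ j, x j = M} =ᵐ[μ]
      ((S.image f : Finset (Fin (q + 1) → ℤ)) : Set (Fin (q + 1) → ℤ)) := by
    have h : ∀ᵐ x ∂μ, ∀ j, x j ∈ Set.range traceVal := by
      rw [ae_all_iff]
      intro j
      exact (Measure.quasiMeasurePreserving_eval (μ := fun _ : Fin (q + 1) => traceLaw q) j).ae
        (ae_mem_range_traceVal q)
    rw [eventuallyEq_set]
    filter_upwards [h] with x hx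
    choose s hs using hx
    have hxs : x = f s := funext fun j => (hs j).symm
    rw [hxs, Finset.mem_coe, Finset.mem_image]
    constructor
    · intro h
      exact ⟨s, Finset.mem_filter.2 ⟨Finset.mem_univ _, h⟩, rfl⟩
    · rintro ⟨s', hs', he⟩
      rw [← hf he]
      exact (Finset.mem_filter.1 hs').2
  rw [traceProb, ← hμ, measureReal_congr hae, ← sum_measureReal_singleton,
    Finset.sum_image hf.injOn, Finset.sum_filter, traceExp]
  refine Finset.sum_congr rfl fun s _ => ?_
  split_ifs
  · rw [mul_one, Measure.real, hμ, Measure.pi_singleton, ENNReal.toReal_prod]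
    exact Finset.prod_congr rfl fun j _ => traceLaw_real_singleton q (s j)
  · rw [mul_zero]

/-- Only the mass at index 1 is small, of order 1/q. A total k can be reached with indices 0 and 2
and at most one index 1, used only for odd k; the other two masses are at least 1/10 for q ≥ 2. -/
theorem exists_le_prod_traceMass {q : ℕ} (hq : 2 ≤ q) (n k : ℕ) (hk : k ≤ 2 * n) :
    ∃ s : Fin n → Fin 3, ∑ j, (s j : ℕ) = k ∧
      (if Even k then (1 / 10 : ℝ) ^ n else (1 / 10 : ℝ) ^ n * (6 / (4 * ((q : ℝ) + 3)))) ≤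
        ∏ j, traceMass q (s j) := by
  have hq' : (2 : ℝ) ≤ q := by exact_mod_cast hq
  have hc0 : 0 < 6 / (4 * ((q : ℝ) + 3)) := by positivity
  have hm0 : (1 / 10 : ℝ) ≤ traceMass q 0 := by
    change (1 / 10 : ℝ) ≤ 3 * ((q : ℝ) + 2) / (4 * ((q : ℝ) + 3))
    rw [div_le_div_iff₀ (by norm_num) (by positivity)]
    linarith
  have hm2 : (1 / 10 : ℝ) ≤ traceMass q 2 := by
    change (1 / 10 : ℝ) ≤ (q : ℝ) / (4 * ((q : ℝ) + 3))
    rw [div_le_div_iff₀ (by norm_num) (by positivity)]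
    linarith
  induction n generalizing k with
  | zero =>
    obtain rfl : k = 0 := by omega
    exact ⟨Fin.elim0, by simp, by simp⟩
  | succ n ih =>
    rcases Nat.lt_or_ge k 2 with h | h
    · obtain ⟨s, hs, hp⟩ := ih 0 (by omega)
      simp only [Even.zero, if_true] at hp
      have hpn : 0 ≤ ∏ j, traceMass q (s j) := Finset.prod_nonneg fun j _ => traceMass_nonneg _ _
      obtain rfl | rfl : k = 0 ∨ k = 1 := by omega
      · refine ⟨Fin.cons 0 s, by simp [Fin.sum_univ_succ, hs], ?_⟩
        simp only [Even.zero, if_true, Fin.prod_univ_succ, Fin.cons_zero, Fin.cons_succ, pow_succ']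
        exact mul_le_mul hm0 hp (by positivity) (traceMass_nonneg _ _)
      · refine ⟨Fin.cons 1 s, by simp [Fin.sum_univ_succ, hs], ?_⟩
        simp only [Nat.not_even_one, if_false, Fin.prod_univ_succ, Fin.cons_zero, Fin.cons_succ,
          pow_succ']
        change _ ≤ 6 / (4 * ((q : ℝ) + 3)) * _
        rw [mul_comm]
        refine mul_le_mul_of_nonneg_left (le_trans ?_ hp) hc0.le
        have : (0 : ℝ) < (1 / 10) ^ n := by positivity
        linarith
    · obtain ⟨s, hs, hp⟩ := ih (k - 2) (by omega)
      refine ⟨Fin.cons 2 s, ?_, ?_⟩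
      · simp only [Fin.sum_univ_succ, Fin.cons_zero, Fin.cons_succ, hs]
        change 2 + (k - 2) = k
        omega
      · have he : Even (k - 2) ↔ Even k := by
          rw [Nat.even_iff, Nat.even_iff]; omega
        simp only [he] at hp
        simp only [Fin.prod_univ_succ, Fin.cons_zero, Fin.cons_succ]
        have hnn : 0 ≤ (if Even k then (1 / 10 : ℝ) ^ n
            else (1 / 10 : ℝ) ^ n * (6 / (4 * ((q : ℝ) + 3)))) := by
          split_ifs <;> positivity
        refine le_trans (le_of_eq ?_) (mul_le_mul hm2 hp hnn (traceMass_nonneg _ _))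
        split_ifs <;> ring

/-- Since `traceVal b = 2b - 1`, the sum depends only on the total of the indices, so an arbitrary
configuration may be replaced by a likely one with the same sum. -/
theorem pow_le_traceProb {q : ℕ} (hq : 2 ≤ q) {s : Fin (q + 1) → Fin 3} :
    (1 / 1000 : ℝ) ^ q ≤ traceProb q (∑ j, traceVal (s j)) := by
  have hval : ∀ b : Fin 3, traceVal b = 2 * ((b : ℕ) : ℤ) - 1 := by decide
  have hsum : ∀ s : Fin (q + 1) → Fin 3,
      ∑ j, traceVal (s j) = 2 * ((∑ j, (s j : ℕ) : ℕ) : ℤ) - (q + 1) := by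
    intro s
    simp only [hval, Finset.sum_sub_distrib, ← Finset.mul_sum]
    simp
  have hk : ∑ j, (s j : ℕ) ≤ 2 * (q + 1) := by
    calc ∑ j, (s j : ℕ) ≤ ∑ _j : Fin (q + 1), 2 := Finset.sum_le_sum fun j _ => by omega
      _ = 2 * (q + 1) := by simp [mul_comm]
  obtain ⟨s', hs', hp⟩ := exists_le_prod_traceMass hq (q + 1) _ hk
  have heq : ∑ j, traceVal (s' j) = ∑ j, traceVal (s j) := by rw [hsum, hsum, hs']
  rw [traceProb_eq_traceExp, traceExp]
  have hq' : (2 : ℝ) ≤ q := by exact_mod_cast hq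
  have hc0 : 0 < 6 / (4 * ((q : ℝ) + 3)) := by positivity
  have hc1 : 6 / (4 * ((q : ℝ) + 3)) ≤ 1 := by
    rw [div_le_one (by positivity)]; linarith
  have hpow : (10 : ℝ) ^ (q + 1) * (4 * ((q : ℝ) + 3)) ≤ 6 * 1000 ^ q := by
    have h1 : (q : ℝ) + 3 ≤ 3 * 2 ^ q := by
      have : (q : ℝ) + 1 ≤ 2 ^ q := by
        have := one_add_mul_le_pow (show (-2 : ℝ) ≤ 1 by norm_num) q
        norm_num at this
        linarith
      linarith
    have h2 : (20 : ℝ) ≤ 50 ^ q := by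
      calc (20 : ℝ) ≤ 50 ^ 1 := by norm_num
        _ ≤ 50 ^ q := pow_le_pow_right₀ (by norm_num) (by omega)
    calc (10 : ℝ) ^ (q + 1) * (4 * ((q : ℝ) + 3)) ≤ 10 ^ (q + 1) * (4 * (3 * 2 ^ q)) := by gcongr
      _ = 6 * (20 * 20 ^ q) := by
          rw [pow_succ, show (20 : ℝ) ^ q = 10 ^ q * 2 ^ q by rw [← mul_pow]; norm_num]; ring
      _ ≤ 6 * (50 ^ q * 20 ^ q) := by gcongr
      _ = 6 * 1000 ^ q := by rw [← mul_pow]; norm_num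
  calc (1 / 1000 : ℝ) ^ q ≤ (1 / 10 : ℝ) ^ (q + 1) * (6 / (4 * ((q : ℝ) + 3))) := by
        rw [one_div_pow, one_div_pow, div_mul_div_comm, div_le_div_iff₀ (by positivity) (by positivity)]
        linarith
    _ ≤ (if Even (∑ j, (s j : ℕ)) then (1 / 10 : ℝ) ^ (q + 1)
          else (1 / 10 : ℝ) ^ (q + 1) * (6 / (4 * ((q : ℝ) + 3)))) := by
        split_ifs
        · exact mul_le_of_le_one_right (by positivity) hc1
        · exact le_rfl
    _ ≤ (∏ j, traceMass q (s' j)) *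
          (if ∑ j, traceVal (s' j) = ∑ j, traceVal (s j) then 1 else 0) := by
        rw [if_pos heq, mul_one]; exact hp
    _ ≤ _ := Finset.single_le_sum (f := fun s' : Fin (q + 1) → Fin 3 =>
          (∏ j, traceMass q (s' j)) *
            (if ∑ j, traceVal (s' j) = ∑ j, traceVal (s j) then (1 : ℝ) else 0))
          (fun s' _ => mul_nonneg (Finset.prod_nonneg fun j _ => traceMass_nonneg _ _)
            (by split_ifs <;> norm_num)) (Finset.mem_univ s')

/-! ### Attainable values of the trace sum. -/

section
variable {F : Type*} [Field F] [Fintype F] [DecidableEq F]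

theorem exists_localTrace_eq {v : Fin 3 → F} (hv : ∀ i j, i ≠ j → ¬ (v i = 0 ∧ v j = 0)) :
    ∃ b, localTrace v = traceVal b := by
  have h : ∀ i, quadraticChar F (v i) = 0 ∨ quadraticChar F (v i) = 1 ∨
      quadraticChar F (v i) = -1 := fun i => by
    rw [quadraticChar_eq_zero_iff]
    exact or_iff_not_imp_left.2 fun h => quadraticChar_dichotomy h
  have h01 := hv 0 1 (by decide)
  have h02 := hv 0 2 (by decide)
  have h12 := hv 1 2 (by decide)
  rw [← quadraticChar_eq_zero_iff, ← quadraticChar_eq_zero_iff] at h01 h02 h12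
  have a := h 0
  have b := h 1
  have c := h 2
  rw [localTrace, map_mul, map_mul, map_mul, Fin.exists_fin_succ, Fin.exists_fin_two]
  change _ = -1 ∨ _ = 1 ∨ _ = 3
  clear h hv
  generalize quadraticChar F (v 0) = x at *
  generalize quadraticChar F (v 1) = y at *
  generalize quadraticChar F (v 2) = z at *
  rcases a with rfl | rfl | rfl <;> rcases b with rfl | rfl | rfl <;>
    rcases c with rfl | rfl | rfl <;> simp_all

/-- Either the three degrees have equal parity and all characters occur, or exactly one pair agrees
and a single sign remains. No relation between the degrees is needed. -/
theorem exists_infTrace_eq (d : Fin 3 → ℕ) {u : Fin 3 → F} (hu : ∀ i, u i ≠ 0) :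
    ∃ b, infTrace d u = traceVal b := by
  have h : ∀ i, quadraticChar F (u i) = 1 ∨ quadraticChar F (u i) = -1 := fun i =>
    quadraticChar_dichotomy (hu i)
  rw [infTrace, map_mul, map_mul, map_mul, Fin.exists_fin_succ, Fin.exists_fin_two]
  change _ = -1 ∨ _ = 1 ∨ _ = 3
  simp only [Nat.odd_add]
  rcases h 0 with a | a <;> rcases h 1 with b | b <;> rcases h 2 with c | c <;> rw [a, b, c] <;>
    by_cases o0 : Odd (d 0) <;> by_cases o1 : Odd (d 1) <;> by_cases o2 : Odd (d 2) <;>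
    simp [o0, o1, o2, ← Nat.not_odd_iff_even]

theorem exists_sum_traceVal_eq_of_coprimeTriples {d : Fin 3 → ℕ} {t : F[X] × F[X] × F[X]}
    (ht : t ∈ coprimeTriples F (d 0) (d 1) (d 2)) :
    ∃ s : Fin (Fintype.card F + 1) → Fin 3, traceSum t = ∑ j, traceVal (s j) := by
  obtain ⟨u₁, u₂, p, hu₁, hu₂, hp, rfl⟩ := exists_scaledTriple_eq ht
  rw [mem_sqfreeTriples] at hp
  rw [traceSum_scaledTriple hu₁ hu₂ hp.1]
  have hu : ∀ i, (![1, u₁, u₂] : Fin 3 → F) i ≠ 0 := by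
    intro i
    fin_cases i
    exacts [one_ne_zero, hu₁, hu₂]
  obtain ⟨b, hb⟩ := exists_infTrace_eq d hu
  have hloc : ∀ x, ∃ b, localTrace (fun i => (![1, u₁, u₂] : Fin 3 → F) i * (p i).eval x) =
      traceVal b := by
    intro x
    refine exists_localTrace_eq fun i j hij h => ?_
    obtain ⟨h1, h2⟩ := h
    have h1 : (X - C x) ∣ p i := dvd_iff_isRoot.2 ((mul_eq_zero.1 h1).resolve_left (hu i))
    have h2 : (X - C x) ∣ p j := dvd_iff_isRoot.2 ((mul_eq_zero.1 h2).resolve_left (hu j))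
    have h3 : (X - C x) * (X - C x) ∣ ∏ k, p k := by
      rw [← Finset.mul_prod_erase _ _ (Finset.mem_univ i)]
      exact mul_dvd_mul h1 (h2.trans (Finset.dvd_prod_of_mem _ (by simp [hij.symm])))
    exact (irreducible_X_sub_C x).not_isUnit (hp.2 _ h3)
  choose s hs using hloc
  refine ⟨Fin.cons b fun j => s ((Fintype.equivFin F).symm j), ?_⟩
  rw [hb, Fin.sum_univ_succ]
  simp only [Fin.cons_zero, Fin.cons_succ, hs]
  rw [(Fintype.equivFin F).symm.sum_comp fun x => traceVal (s x)]

theorem exists_sum_traceVal_eq {n n₁ n₂ : ℕ} {t : F[X] × F[X] × F[X]}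
    (ht : t ∈ biquadraticTriples F n n₁ n₂) :
    ∃ s : Fin (Fintype.card F + 1) → Fin 3, traceSum t = ∑ j, traceVal (s j) := by
  rcases ht with ht | ⟨d, -, ht⟩ | ⟨d, -, ht⟩ | ⟨d, -, ht⟩
  · exact exists_sum_traceVal_eq_of_coprimeTriples (d := ![n, n₁, n₂]) ht
  · exact exists_sum_traceVal_eq_of_coprimeTriples (d := ![d, n₁, n₂]) ht
  · exact exists_sum_traceVal_eq_of_coprimeTriples (d := ![n, d, n₂]) ht
  · exact exists_sum_traceVal_eq_of_coprimeTriples (d := ![n, n₁, d]) ht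
end

/-! ### From weighted counts to proportions. -/

/-- Once q ≥ A^(1/c) one has A ≤ q^c; for smaller q the left side is bounded. -/
theorem exists_pow_le_mul_rpow {A c : ℝ} (hA : 1 ≤ A) (hc : 0 < c) :
    ∃ C : ℝ, 0 < C ∧ ∀ q : ℕ, 1 ≤ q → A ^ q ≤ C * (q : ℝ) ^ (c * q) := by
  have hA0 : 0 < A := by linarith
  refine ⟨A ^ (A ^ (1 / c)), by positivity, fun q hq => ?_⟩
  have hq' : (1 : ℝ) ≤ q := by exact_mod_cast hq
  have hq0 : (0 : ℝ) < q := by linarith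
  rcases le_total (A ^ (1 / c)) q with h | h
  · have h1 : A ≤ (q : ℝ) ^ c := by
      have := Real.rpow_le_rpow (by positivity) h hc.le
      rwa [← Real.rpow_mul hA0.le, one_div_mul_cancel hc.ne', Real.rpow_one] at this
    calc A ^ q ≤ ((q : ℝ) ^ c) ^ q := pow_le_pow_left₀ hA0.le h1 q
      _ = (q : ℝ) ^ (c * q) := by rw [← Real.rpow_natCast, ← Real.rpow_mul hq0.le]
      _ ≤ _ := le_mul_of_one_le_left (by positivity) (Real.one_le_rpow hA (by positivity))
  · calc A ^ q = A ^ (q : ℝ) := (Real.rpow_natCast _ _).symm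
      _ ≤ A ^ (A ^ (1 / c)) := Real.rpow_le_rpow_of_exponent_le hA h
      _ ≤ _ := le_mul_of_one_le_right (by positivity) (Real.one_le_rpow hq' (by positivity))

theorem abs_div_sub_le {N D A P Y : ℝ} (hA : 0 < A) (hP : 0 ≤ P) (hY : Y ≤ 1 / 2)
    (hN : |N - A * P| ≤ Y * (A * P)) (hD : |D - A| ≤ Y * A) : |N / D - P| ≤ 4 * Y * P := by
  have hY0 : 0 ≤ Y := by
    have := (abs_nonneg _).trans hD
    exact nonneg_of_mul_nonneg_left this hA
  have hD' : A / 2 ≤ D := by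
    rw [abs_le] at hD
    nlinarith [hD.1]
  have hD0 : 0 < D := by linarith
  rw [show N / D - P = (N - P * D) / D by field_simp, abs_div, abs_of_pos hD0, div_le_iff₀ hD0]
  calc |N - P * D| = |(N - A * P) - P * (D - A)| := by ring_nf
    _ ≤ |N - A * P| + |P * (D - A)| := abs_sub _ _
    _ ≤ Y * (A * P) + P * (Y * A) := by
        rw [abs_mul, abs_of_nonneg hP]
        exact add_le_add hN (mul_le_mul_of_nonneg_left hD hP)
    _ = 4 * Y * P * (A / 2) := by ring
    _ ≤ 4 * Y * P * D := by gcongr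

theorem finite_natDegree_le (F : Type*) [Field F] [Fintype F] (n : ℕ) :
    {f : F[X] | f.natDegree ≤ n}.Finite := by
  have h : {f : F[X] | f.natDegree ≤ n} ⊆ (degreeLT F (n + 1) : Set F[X]) := by
    intro f hf
    rw [SetLike.mem_coe, mem_degreeLT]
    exact lt_of_le_of_lt (degree_le_natDegree) (by exact_mod_cast Nat.lt_succ_of_le hf)
  have : Finite (degreeLT F (n + 1)) := Finite.of_equiv _ (degreeLTEquiv F (n + 1)).toEquiv.symm
  exact (Set.toFinite (degreeLT F (n + 1) : Set F[X])).subset h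

theorem finite_biquadraticTriples (F : Type*) [Field F] [Fintype F] (n n₁ n₂ : ℕ) :
    (biquadraticTriples F n n₁ n₂).Finite := by
  refine ((finite_natDegree_le F n).prod ((finite_natDegree_le F n₁).prod
    (finite_natDegree_le F n₂))).subset ?_
  rintro t (ht | ⟨d, hd, ht⟩ | ⟨d, hd, ht⟩ | ⟨d, hd, ht⟩) <;>
  · obtain ⟨-, -, -, -, h0, h1, h2, -⟩ := ht
    exact ⟨by simp only [Set.mem_ofPred_eq]; omega, by simp only [Set.mem_ofPred_eq]; omega,
      by simp only [Set.mem_ofPred_eq]; omega⟩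

section
variable {F : Type*} [Field F] [Fintype F] [DecidableEq F]

theorem traceProb_nonneg (q : ℕ) (M : ℤ) : 0 ≤ traceProb q M := measureReal_nonneg

theorem traceProb_le_one (q : ℕ) (M : ℤ) : traceProb q M ≤ 1 := measureReal_le_one

theorem traceProportion_nonneg (M : ℤ) (n n₁ n₂ : ℕ) : 0 ≤ traceProportion F M n n₁ n₂ := by
  rw [traceProportion]; positivity

theorem traceProportion_le_one (M : ℤ) (n n₁ n₂ : ℕ) : traceProportion F M n n₁ n₂ ≤ 1 := by
  refine div_le_one_of_le₀ ?_ (Nat.cast_nonneg _)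
  have h : {t ∈ biquadraticTriples F n n₁ n₂ | traceSum t = M} ⊆ biquadraticTriples F n n₁ n₂ :=
    fun _ ht => ht.1
  exact_mod_cast Set.ncard_le_ncard h (finite_biquadraticTriples F n n₁ n₂)

/-- An attained M is a sum of q+1 values of the law. This also covers an empty family, where the
quotient 0/0 is 0. -/
theorem traceProportion_eq_zero_or (M : ℤ) (n n₁ n₂ : ℕ) :
    traceProportion F M n n₁ n₂ = 0 ∨ (1 / 1000 : ℝ) ^ Fintype.card F ≤
      traceProb (Fintype.card F) M := by
  rcases Set.eq_empty_or_nonempty {t ∈ biquadraticTriples F n n₁ n₂ | traceSum t = M} with h | h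
  · left
    rw [traceProportion, h]
    simp
  · right
    obtain ⟨t, ht, rfl⟩ := h
    obtain ⟨s, hs⟩ := exists_sum_traceVal_eq ht
    rw [hs]
    exact pow_le_traceProb Fintype.one_lt_card

theorem traceProportion_eq_div (M : ℤ) {d : Fin 3 → ℕ} (hd : ∀ i, 1 ≤ d i) :
    traceProportion F M (d 0) (d 1) (d 2) =
      (∑ t ∈ biquadraticFinset F d, if traceSum t = M then (1 : ℝ) else 0) /
        ∑ _t ∈ biquadraticFinset F d, (1 : ℝ) := by
  rw [traceProportion, ← coe_biquadraticFinset hd, Set.ncard_coe_finset, Finset.sum_boole,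
    Finset.sum_const, nsmul_eq_mul, mul_one]
  congr 2
  rw [← Set.ncard_coe_finset]
  congr 1
  ext t
  simp

theorem abs_traceProportion_sub_le_of_small (hF : ringChar F ≠ 2) (M : ℤ) {d : Fin 3 → ℕ}
    (hd : ∀ i, 1 ≤ d i)
    (h01 : d 0 % 2 = d 1 % 2) (h12 : d 1 % 2 = d 2 % 2) {θ m : ℝ} (hθ0 : 0 < θ) (hθ1 : θ < 1 / 2)
    (hm : ∀ i, m + 1 ≤ d i) (hq : (Fintype.card F : ℝ) ≤ θ * m)
    (hY : sieveErrorConst θ * 108 ^ Fintype.card F *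
      (Fintype.card F : ℝ) ^ ((Fintype.card F : ℝ) - θ * m) ≤ 1 / 2) :
    |traceProportion F M (d 0) (d 1) (d 2) - traceProb (Fintype.card F) M| ≤
      4 * (sieveErrorConst θ * 108 ^ Fintype.card F *
      (Fintype.card F : ℝ) ^ ((Fintype.card F : ℝ) - θ * m)) * traceProb (Fintype.card F) M := by
  obtain ⟨A, hA, h⟩ := abs_sum_biquadraticFinset_sub_le hF hd h01 h12 hθ0 hθ1 hm hq
  have hN := h (fun z => if z = M then 1 else 0) (fun z => by split_ifs <;> norm_num)
  have hD := h (fun _ => 1) (fun _ => zero_le_one)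
  rw [traceExp_one, mul_one] at hD
  rw [← traceProb_eq_traceExp] at hN
  rw [traceProportion_eq_div M hd]
  exact abs_div_sub_le hA (traceProb_nonneg _ _) hY hN hD
end

/-! ### Uniform constants and the conclusion. -/

/-- The size of the error term in the trace distribution. -/
noncomputable def traceErrorBase (q : ℕ) (ε : ℝ) (m : ℕ) : ℝ :=
  (q : ℝ) ^ (-((1 - ε) / 2) * (m : ℝ) + q)

theorem two_pow_ge_self {q : ℕ} : (q : ℝ) ≤ 2 ^ q := by
  exact_mod_cast q.lt_two_pow_self.le

/-- With θ = (1 - ε/2)/2 the exponent exceeds what is needed by εm/4 ≥ εq/4, up to one factor q ≤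
2^q lost in passing from m - 1 to m. The slack q^(εq/4) absorbs 216^q = (108 · 2)^q. -/
theorem exists_bound_of_small {ε : ℝ} (hε0 : 0 < ε) (hε1 : ε < 1) :
    ∃ C : ℝ, 0 < C ∧ ∀ q m : ℕ, 2 ≤ q → (q : ℝ) ≤ (1 - ε / 2) / 2 * ((m : ℝ) - 1) →
      4 * (sieveErrorConst ((1 - ε / 2) / 2) * 108 ^ q *
        (q : ℝ) ^ ((q : ℝ) - (1 - ε / 2) / 2 * ((m : ℝ) - 1))) ≤ C * traceErrorBase q ε m := by
  obtain ⟨C₂, hC₂, h⟩ := exists_pow_le_mul_rpow (A := 216) (c := ε / 4) (by norm_num) (by linarith)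
  have hC₁ := one_le_sieveErrorConst (θ := (1 - ε / 2) / 2) (by linarith)
  set C₁ := sieveErrorConst ((1 - ε / 2) / 2)
  refine ⟨4 * C₁ * C₂, by positivity, fun q m hq hm => ?_⟩
  have hq' : (2 : ℝ) ≤ q := by exact_mod_cast hq
  have hq0 : (0 : ℝ) < q := by linarith
  have hmq : (q : ℝ) ≤ m := by nlinarith
  have h1 : (q : ℝ) ^ ((q : ℝ) - (1 - ε / 2) / 2 * ((m : ℝ) - 1)) ≤
      traceErrorBase q ε m * (2 ^ q / (q : ℝ) ^ (ε / 4 * q)) := by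
    calc (q : ℝ) ^ ((q : ℝ) - (1 - ε / 2) / 2 * ((m : ℝ) - 1))
        ≤ (q : ℝ) ^ ((-((1 - ε) / 2) * (m : ℝ) + q) + 1 - ε / 4 * q) :=
          Real.rpow_le_rpow_of_exponent_le (by linarith) (by nlinarith)
      _ = traceErrorBase q ε m * (q / (q : ℝ) ^ (ε / 4 * q)) := by
          rw [traceErrorBase, Real.rpow_sub hq0, Real.rpow_add hq0, Real.rpow_one]
          ring
      _ ≤ _ := by
          have : 0 ≤ traceErrorBase q ε m := Real.rpow_nonneg hq0.le _
          gcongr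
          exact two_pow_ge_self
  have h2 : (216 : ℝ) ^ q / (q : ℝ) ^ (ε / 4 * q) ≤ C₂ := by
    rw [div_le_iff₀ (by positivity)]
    exact h q (by omega)
  have hx : 0 ≤ traceErrorBase q ε m := Real.rpow_nonneg hq0.le _
  calc 4 * (C₁ * 108 ^ q * (q : ℝ) ^ ((q : ℝ) - (1 - ε / 2) / 2 * ((m : ℝ) - 1)))
      ≤ 4 * (C₁ * 108 ^ q * (traceErrorBase q ε m * (2 ^ q / (q : ℝ) ^ (ε / 4 * q)))) := by
        gcongr
    _ = 4 * C₁ * traceErrorBase q ε m * (216 ^ q / (q : ℝ) ^ (ε / 4 * q)) := by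
        rw [show (216 : ℝ) = 108 * 2 by norm_num, mul_pow]
        ring
    _ ≤ 4 * C₁ * traceErrorBase q ε m * C₂ := by gcongr
    _ = _ := by ring

/-- The hypothesis bounds q^(q - θ(m-1)) below by an exponential in -q. The target base has exponent
-(1-ε)m/2 + q, whose coefficient of m is τ times that of the hypothesis, and the leftover q^((1-τ)q)
absorbs 216000^q = (1000 · 108 · 2)^q. -/
theorem exists_bound_of_large {ε : ℝ} (hε0 : 0 < ε) (hε1 : ε < 1) :
    ∃ C : ℝ, 0 < C ∧ ∀ q m : ℕ, 2 ≤ q →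
      1 / 2 < sieveErrorConst ((1 - ε / 2) / 2) * 108 ^ q *
        (q : ℝ) ^ ((q : ℝ) - (1 - ε / 2) / 2 * ((m : ℝ) - 1)) →
      1 ≤ (1 / 1000) ^ q * (C * traceErrorBase q ε m) := by
  set τ := (1 - ε) / (1 - ε / 2) with hτ
  have hε2 : 0 < 1 - ε / 2 := by linarith
  have hτ0 : 0 < τ := div_pos (by linarith) hε2
  have hτ1 : τ < 1 := by rw [hτ, div_lt_one hε2]; linarith
  obtain ⟨C₃, hC₃, h⟩ := exists_pow_le_mul_rpow (A := 216000) (c := 1 - τ) (by norm_num)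
    (by linarith)
  have hC₁ := one_le_sieveErrorConst (θ := (1 - ε / 2) / 2) (by linarith)
  set C₁ := sieveErrorConst ((1 - ε / 2) / 2)
  refine ⟨2 * C₁ * C₃, by positivity, fun q m hq hm => ?_⟩
  have hq' : (2 : ℝ) ≤ q := by exact_mod_cast hq
  have hq0 : (0 : ℝ) < q := by linarith
  set z := (q : ℝ) ^ ((q : ℝ) - (1 - ε / 2) / 2 * ((m : ℝ) - 1)) with hz
  have hz0 : 1 / (2 * C₁ * 108 ^ q) ≤ z := by
    rw [div_le_iff₀ (by positivity)]
    linarith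
  have hzτ : 1 / (2 * C₁ * 108 ^ q) ≤ z ^ τ := by
    have h108 : (1 : ℝ) ≤ 108 ^ q := one_le_pow₀ (by norm_num)
    have hle1 : 1 / (2 * C₁ * 108 ^ q) ≤ 1 := by
      rw [div_le_one (by positivity)]
      nlinarith
    calc 1 / (2 * C₁ * 108 ^ q) = (1 / (2 * C₁ * 108 ^ q)) ^ (1 : ℝ) := (Real.rpow_one _).symm
      _ ≤ (1 / (2 * C₁ * 108 ^ q)) ^ τ :=
          Real.rpow_le_rpow_of_exponent_ge (by positivity) hle1 hτ1.le
      _ ≤ z ^ τ := Real.rpow_le_rpow (by positivity) hz0 hτ0.le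
  have hx : z ^ τ * ((q : ℝ) ^ ((1 - τ) * q) / 2 ^ q) ≤ traceErrorBase q ε m := by
    calc z ^ τ * ((q : ℝ) ^ ((1 - τ) * q) / 2 ^ q) ≤ z ^ τ * ((q : ℝ) ^ ((1 - τ) * q) / q) := by
          have : 0 ≤ z := by positivity
          gcongr
          exact two_pow_ge_self
      _ = (q : ℝ) ^ (((q : ℝ) - (1 - ε / 2) / 2 * ((m : ℝ) - 1)) * τ + ((1 - τ) * q - 1)) := by
          rw [hz, ← Real.rpow_mul hq0.le, Real.rpow_add hq0, Real.rpow_sub hq0 ((1 - τ) * q),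
            Real.rpow_one]
      _ ≤ traceErrorBase q ε m := by
          rw [traceErrorBase]
          apply Real.rpow_le_rpow_of_exponent_le (by linarith)
          have hτe : (1 - ε / 2) * τ = 1 - ε := by
            rw [hτ, mul_div_assoc', mul_div_cancel_left₀ _ hε2.ne']
          have : ((q : ℝ) - (1 - ε / 2) / 2 * ((m : ℝ) - 1)) * τ =
              q * τ - (1 - ε) / 2 * ((m : ℝ) - 1) := by rw [← hτe]; ring
          rw [this]
          linarith
  have h3 := h q (by omega)
  calc (1 : ℝ) ≤ C₃ * (q : ℝ) ^ ((1 - τ) * q) / 216000 ^ q := by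
        rw [le_div_iff₀ (by positivity), one_mul]
        exact h3
    _ = (1 / 1000) ^ q * (2 * C₁ * C₃ *
          (1 / (2 * C₁ * 108 ^ q) * ((q : ℝ) ^ ((1 - τ) * q) / 2 ^ q))) := by
        rw [show (216000 : ℝ) = 1000 * (108 * 2) by norm_num, mul_pow, mul_pow, one_div_pow]
        field_simp
    _ ≤ (1 / 1000) ^ q * (2 * C₁ * C₃ * (z ^ τ * ((q : ℝ) ^ ((1 - τ) * q) / 2 ^ q))) := by
        gcongr
    _ ≤ _ := by gcongr

theorem exists_abs_traceProportion_sub_le {ε : ℝ} (hε0 : 0 < ε) (hε1 : ε < 1) :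
    ∃ C : ℝ, ∀ (F : Type u) [Field F] [Fintype F] [DecidableEq F], ringChar F ≠ 2 →
      ∀ (M : ℤ) (n n₁ n₂ : ℕ), SameParity n n₁ n₂ →
        |traceProportion F M n n₁ n₂ - traceProb (Fintype.card F) M| ≤
          traceProb (Fintype.card F) M *
            (C * (Fintype.card F : ℝ) ^
              (-((1 - ε) / 2) * (min n (min n₁ n₂) : ℕ) + (Fintype.card F : ℝ))) := by
  obtain ⟨C₁, hC₁, h₁⟩ := exists_bound_of_small hε0 hε1
  obtain ⟨C₂, hC₂, h₂⟩ := exists_bound_of_large hε0 hε1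
  refine ⟨C₁ + C₂, fun F _ _ _ hF M n n₁ n₂ hpar => ?_⟩
  change _ ≤ _ * ((C₁ + C₂) * traceErrorBase (Fintype.card F) ε (min n (min n₁ n₂)))
  set q := Fintype.card F with hqdef
  set m := min n (min n₁ n₂) with hm
  set P := traceProb q M with hP
  have hq2 : 2 ≤ q := Fintype.one_lt_card
  have hq' : (2 : ℝ) ≤ q := by exact_mod_cast hq2
  have hP0 : 0 ≤ P := traceProb_nonneg q M
  have hx : 0 ≤ traceErrorBase q ε m := Real.rpow_nonneg (by linarith) _
  have hE := one_le_sieveErrorConst (θ := (1 - ε / 2) / 2) (by linarith)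
  rcases le_or_gt (sieveErrorConst ((1 - ε / 2) / 2) * 108 ^ q *
      (q : ℝ) ^ ((q : ℝ) - (1 - ε / 2) / 2 * ((m : ℝ) - 1))) (1 / 2) with hY | hY
  -- Otherwise the exponent would be nonnegative and the relative error at least 1.
  · have hqm : (q : ℝ) ≤ (1 - ε / 2) / 2 * ((m : ℝ) - 1) := by
      by_contra! hlt
      have h1 : 1 ≤ (q : ℝ) ^ ((q : ℝ) - (1 - ε / 2) / 2 * ((m : ℝ) - 1)) :=
        Real.one_le_rpow (by linarith) (by linarith)
      have h2 : (1 : ℝ) ≤ 108 ^ q := one_le_pow₀ (by norm_num)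
      have h3 := one_le_mul_of_one_le_of_one_le hE h2
      have h4 := one_le_mul_of_one_le_of_one_le h3 h1
      linarith
    have hm1 : 1 ≤ m := by
      by_contra! hlt
      rw [show m = 0 by omega] at hqm
      push_cast at hqm
      nlinarith
    have hmd : ∀ i, m ≤ (![n, n₁, n₂] : Fin 3 → ℕ) i := by
      intro i
      fin_cases i
      · exact min_le_left _ _
      · exact (min_le_right _ _).trans (min_le_left _ _)
      · exact (min_le_right _ _).trans (min_le_right _ _)
    refine (abs_traceProportion_sub_le_of_small hF M (d := ![n, n₁, n₂]) (fun i => hm1.trans (hmd i))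
      hpar.1 hpar.2 (θ := (1 - ε / 2) / 2) (m := (m : ℝ) - 1) (by linarith) (by linarith) ?_ hqm
      hY).trans ?_
    · intro i
      rw [sub_add_cancel]
      exact_mod_cast hmd i
    · rw [mul_comm]
      refine mul_le_mul_of_nonneg_left ((h₁ q m hq2 hqm).trans ?_) hP0
      nlinarith
  · have hbig := h₂ q m hq2 hY
    have hCx : C₂ * traceErrorBase q ε m ≤ (C₁ + C₂) * traceErrorBase q ε m := by nlinarith
    have hR0 := traceProportion_nonneg (F := F) M n n₁ n₂
    have hR1 := traceProportion_le_one (F := F) M n n₁ n₂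
    have hP1 : P ≤ 1 := traceProb_le_one q M
    have hp0 : (0 : ℝ) ≤ (1 / 1000) ^ q := by positivity
    have hCx0 : 0 ≤ C₂ * traceErrorBase q ε m := by positivity
    -- Here the claimed relative bound is at least 1, which settles an unattained M. For an attained
    -- M the bound exceeds 1 even after multiplication by 1000^(-q) ≤ P, while the difference of two
    -- numbers in [0, 1] is at most 1.
    rcases traceProportion_eq_zero_or (F := F) M n n₁ n₂ with h0 | h0
    · rw [h0, zero_sub, abs_neg, abs_of_nonneg hP0]
      have h1 : 1 ≤ C₂ * traceErrorBase q ε m := hbig.trans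
        (mul_le_of_le_one_left hCx0 (pow_le_one₀ (by norm_num) (by norm_num)))
      exact le_mul_of_one_le_right hP0 (h1.trans hCx)
    · calc _ ≤ (1 : ℝ) := by rw [abs_le]; constructor <;> linarith
        _ ≤ (1 / 1000) ^ q * (C₂ * traceErrorBase q ε m) := hbig
        _ ≤ P * (C₂ * traceErrorBase q ε m) := mul_le_mul_of_nonneg_right h0 hCx0
        _ ≤ _ := mul_le_mul_of_nonneg_left hCx hP0

theorem tendsto_min_three :
    Tendsto (fun d : ℕ × ℕ × ℕ => min d.1 (min d.2.1 d.2.2)) atTop atTop := by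
  rw [tendsto_atTop]
  intro b
  filter_upwards [eventually_ge_atTop (b, b, b)] with d hd
  exact le_min hd.1 (le_min hd.2.1 hd.2.2)

theorem theorem4p1 :
    (∀ (F : Type u) [Field F] [Fintype F] [DecidableEq F], ringChar F ≠ 2 → ∀ M : ℤ,
      Tendsto (fun d : ℕ × ℕ × ℕ => traceProportion F M d.1 d.2.1 d.2.2)
        (atTop ⊓ Filter.principal {d | SameParity d.1 d.2.1 d.2.2})
        (nhds (traceProb (Fintype.card F) M))) ∧
    (∀ ε : ℝ, 0 < ε → ε < 1 → ∃ C : ℝ,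
      ∀ (F : Type u) [Field F] [Fintype F] [DecidableEq F], ringChar F ≠ 2 →
      ∀ (M : ℤ) (n n₁ n₂ : ℕ), SameParity n n₁ n₂ →
        |traceProportion F M n n₁ n₂ - traceProb (Fintype.card F) M| ≤
          traceProb (Fintype.card F) M *
            (C * (Fintype.card F : ℝ) ^
              (-((1 - ε) / 2) * (min n (min n₁ n₂) : ℕ) + (Fintype.card F : ℝ)))) := by
  refine ⟨fun F _ _ _ hF M => ?_, fun ε hε0 hε1 => exists_abs_traceProportion_sub_le hε0 hε1⟩
  -- For a fixed field any ε will do: the exponent tends to -∞ with the smallest degree.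
  obtain ⟨C, hC⟩ := exists_abs_traceProportion_sub_le.{u} (ε := 1 / 2) (by norm_num) (by norm_num)
  have hexp : Tendsto (fun d : ℕ × ℕ × ℕ => (-((1 - 1 / 2) / 2 : ℝ)) *
      ((min d.1 (min d.2.1 d.2.2) : ℕ) : ℝ) + (Fintype.card F : ℝ)) atTop atBot :=
    tendsto_atBot_add_const_right _ _
      ((tendsto_natCast_atTop_atTop.comp tendsto_min_three).const_mul_atTop_of_neg (by norm_num))
  have hlim := (((tendsto_rpow_atBot_of_base_gt_one (Fintype.card F : ℝ)
    one_lt_card_real).comp hexp).const_mul C).const_mul (traceProb (Fintype.card F) M)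
  rw [mul_zero, mul_zero] at hlim
  rw [tendsto_iff_norm_sub_tendsto_zero]
  refine squeeze_zero' (Eventually.of_forall fun _ => norm_nonneg _) ?_ (hlim.mono_left inf_le_left)
  filter_upwards [mem_inf_of_right (mem_principal_self _)] with d hd
  exact hC F hF M d.1 d.2.1 d.2.2 hd
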